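/- All matroids are finite. A matroid is \emph{simple} if it has no loops and no two distinct parallel elements, and \emph{connected} if its ground set is non-empty and any two distinct elements lie in a common circuit. An \emph{induced minor} of a simple matroid $M$ is a matroid obtained from $M$ by a sequence of restrictions to flats and contractions, each contraction being followed by a simplification; $M$ \emph{has $N$ as an induced minor} if some induced minor of $M$ is isomorphic to $N$. A graph (loops and multiple edges allowed) is a \emph{series-parallel network} if it can be obtained from a loop or from $K_2$ by a sequence of operations, each of which replaces a graph $G$ by a graph $H$ such that either $G = H\backslash f$ for an edge $f$ of $H$ that is parallel to another edge of $H$ (a parallel extension), or $G = H/f$ for an edge $f$ of $H$ that is in series with another edge $g$ of $H$, that is, $\{f,g\}$ is a bond of $H$ (a series extension). A matroid is a \emph{series-parallel network} if it is the cycle matroid $M(G)$ of a graph $G$ that is a series-parallel network. Let $M(K_4)$ be the cycle matroid of the complete graph on four vertices and let $F_7$ be the Fano matroid. \textbf{Lemma.} A matroid $M$ is simple, binary (that is, representable over $GF(2)$), connected, and has neither $M(K_4)$ nor $F_7$ as an induced minor if and only if $M$ is a simple series-parallel network. -/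

import Mathlib

/-! ### Cycle matroids of multigraphs -/

namespace Graph

/-- `C` is the edge set of a cycle of `G`: there are distinct vertices `v 0, …, v n` and distinct
edges `e 0, …, e n` such that `e i` joins `v i` to `v (i + 1)`, indices being read cyclically
(addition in `Fin (n + 1)` wraps around). So a loop is a cycle with one edge and two distinct
non-loop edges with the same ends form a cycle with two edges. -/
def IsCycleSet {V E : Type*} (G : Graph V E) (C : Set E) : Prop :=
  ∃ (n : ℕ) (v : Fin (n + 1) → V) (e : Fin (n + 1) → E),
    Function.Injective v ∧ Function.Injective e ∧
      (∀ i, G.IsLink (e i) (v i) (v (i + 1))) ∧ C = Set.range e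

/-- A set of edges is a forest if it contains the edge set of no cycle. -/
def IsForest {V E : Type*} (G : Graph V E) (F : Set E) : Prop :=
  F ⊆ G.edgeSet ∧ ∀ C ⊆ F, ¬ G.IsCycleSet C

/-- `G.Joined F x y`: there is a walk from `x` to `y` all of whose edges lie in `F`. -/
def Joined {V E : Type*} (G : Graph V E) (F : Set E) : V → V → Prop :=
  Relation.ReflTransGen (fun x y => ∃ e ∈ F, G.IsLink e x y)

theorem Joined.symm {V E : Type*} {G : Graph V E} {F : Set E} {x y : V} (h : G.Joined F x y) :
    G.Joined F y x := by
  induction h with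
  | refl => exact Relation.ReflTransGen.refl
  | tail _ h2 ih =>
    obtain ⟨e, he, hl⟩ := h2
    exact Relation.ReflTransGen.head ⟨e, he, hl.symm⟩ ih

theorem Joined.mono {V E : Type*} {G : Graph V E} {F F' : Set E} (hF : F ⊆ F') {x y : V}
    (h : G.Joined F x y) : G.Joined F' x y :=
  Relation.ReflTransGen.mono (fun _ _ ⟨e, he, hl⟩ => ⟨e, hF he, hl⟩) _ _ h

theorem Joined.trans {V E : Type*} {G : Graph V E} {F : Set E} {x y z : V}
    (h : G.Joined F x y) (h' : G.Joined F y z) : G.Joined F x z :=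
  Relation.ReflTransGen.trans h h'

theorem Joined.exists_path {V E : Type*} {G : Graph V E} {F : Set E} {x y : V}
    (h : G.Joined F x y) : ∃ (n : ℕ) (v : ℕ → V), v 0 = x ∧ v n = y ∧
      (∀ i < n, ∃ e ∈ F, G.IsLink e (v i) (v (i + 1))) ∧
      (∀ i j, i < j → j ≤ n → v i ≠ v j) := by
  classical
  have hex : ∃ n : ℕ, ∃ v : ℕ → V, v 0 = x ∧ v n = y ∧
      ∀ i < n, ∃ e ∈ F, G.IsLink e (v i) (v (i + 1)) := by
    induction h with
    | refl => exact ⟨0, fun _ => x, rfl, rfl, by simp⟩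
    | @tail b c _ hbc ih =>
      obtain ⟨n, v, h0, hn, hv⟩ := ih
      refine ⟨n + 1, fun i => if i ≤ n then v i else c, by simp [h0], by simp, ?_⟩
      intro i hi
      rcases Nat.lt_succ_iff_lt_or_eq.1 hi with hi' | rfl
      · simpa [hi'.le, Nat.succ_le_of_lt hi'] using hv i hi'
      · simpa [hn] using hbc
  obtain ⟨v, h0, hn, hv⟩ := Nat.find_spec hex
  refine ⟨Nat.find hex, v, h0, hn, hv, ?_⟩
  intro i j hij hj heq
  set n := Nat.find hex with hndef
  have hlt : n - (j - i) < n := by omega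
  refine Nat.find_min hex (m := n - (j - i)) hlt
    ⟨fun k => if k ≤ i then v k else v (k + (j - i)), by simp [h0], ?_, ?_⟩
  · by_cases hk : n - (j - i) ≤ i
    · have h1 : n - (j - i) = i := by omega
      have h2 : j = n := by omega
      simp only [h1, le_refl, if_true]
      rw [heq, h2, hn]
    · simp only [hk, if_false]
      rw [show n - (j - i) + (j - i) = n by omega, hn]
  · intro k hk
    by_cases h1 : k + 1 ≤ i
    · simpa [h1, show k ≤ i by omega] using hv k (by omega)
    · by_cases h2 : k = i
      · subst h2
        have := hv j (by omega)
        simpa [heq, show k + 1 + (j - k) = j + 1 by omega] using this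
      · have := hv (k + (j - i)) (by omega)
        simpa [h1, show ¬ k ≤ i by omega, show k + 1 + (j - i) = k + (j - i) + 1 by omega]
          using this

theorem Joined.exists_isCycleSet {V E : Type*} {G : Graph V E} {F : Set E} {x y : V} {e : E}
    (he : e ∉ F) (hl : G.IsLink e y x) (h : G.Joined F x y) :
    ∃ C ⊆ insert e F, G.IsCycleSet C := by
  obtain ⟨n, v, h0, hn, hv, hinj⟩ := h.exists_path
  have : Nonempty E := ⟨e⟩
  choose! f hfF hf using hv
  have hvinj : ∀ i j, i ≤ n → j ≤ n → v i = v j → i = j := by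
    intro i j hi hj hvij
    rcases lt_trichotomy i j with hij | hij | hij
    · exact absurd hvij (hinj i j hij hj)
    · exact hij
    · exact absurd hvij.symm (hinj j i hij hi)
  have hfinj : ∀ i j, i < j → j < n → f i ≠ f j := by
    intro i j hij hj hfij
    have h1 := hf i (by omega)
    rw [hfij] at h1
    rcases h1.left_eq_or_eq (hf j hj) with h2 | h2
    · exact hinj i j hij (by omega) h2
    · exact hinj i (j + 1) (by omega) (by omega) h2
  refine ⟨_, ?_, n, fun i => v i, fun i => if (i : ℕ) < n then f i else e, ?_, ?_, ?_, rfl⟩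
  · rintro _ ⟨i, rfl⟩
    by_cases hi : (i : ℕ) < n
    · simpa [hi] using Or.inr (hfF i hi)
    · simp [hi]
  · intro i j hij
    exact Fin.ext (hvinj i j (by omega) (by omega) hij)
  · intro i j hij
    by_cases hi : (i : ℕ) < n <;> by_cases hj : (j : ℕ) < n
    · simp only [hi, hj, if_true] at hij
      apply Fin.ext
      rcases lt_trichotomy (i : ℕ) j with h1 | h1 | h1
      · exact absurd hij (hfinj _ _ h1 hj)
      · exact h1
      · exact absurd hij.symm (hfinj _ _ h1 hi)
    · simp only [hi, hj, if_true, if_false] at hij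
      exact absurd (hij ▸ hfF i hi) he
    · simp only [hi, hj, if_true, if_false] at hij
      exact absurd (hij.symm ▸ hfF j hj) he
    · exact Fin.ext (by omega)
  · intro i
    by_cases hi : (i : ℕ) < n
    · have h1 : ((i + 1 : Fin (n + 1)) : ℕ) = i + 1 := by
        rw [Fin.val_add_one]
        have : i ≠ Fin.last n := by
          rintro rfl
          simp at hi
        simp [this]
      simpa [hi, h1] using hf i hi
    · have h1 : i = Fin.last n := Fin.ext (by simp; omega)
      subst h1
      simpa [hn, h0] using hl

theorem IsCycleSet.joined {V E : Type*} {G : Graph V E} {C : Set E} (hC : G.IsCycleSet C) :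
    ∃ e ∈ C, ∃ x y, G.IsLink e x y ∧ G.Joined (C \ {e}) y x := by
  obtain ⟨n, v, e, hv, he, hl, rfl⟩ := hC
  refine ⟨e (Fin.last n), ⟨_, rfl⟩, v (Fin.last n), v (Fin.last n + 1), hl _, ?_⟩
  have key : ∀ k (hk : k < n + 1), G.Joined (Set.range e \ {e (Fin.last n)}) (v 0) (v ⟨k, hk⟩) := by
    intro k
    induction k with
    | zero => intro _; exact Relation.ReflTransGen.refl
    | succ k ih =>
      intro hk
      refine Relation.ReflTransGen.tail (ih (by omega)) ⟨e ⟨k, by omega⟩, ⟨⟨_, rfl⟩, ?_⟩, ?_⟩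
      · intro h
        have := congrArg Fin.val (he h)
        simp at this
        omega
      · have h1 : (⟨k, by omega⟩ + 1 : Fin (n + 1)) = ⟨k + 1, hk⟩ := by
          apply Fin.ext
          rw [Fin.val_add_one]
          have : (⟨k, by omega⟩ : Fin (n + 1)) ≠ Fin.last n := by
            intro h
            have := congrArg Fin.val h
            simp at this
            omega
          simp [this]
        rw [← h1]
        exact hl _
  have hlast : (Fin.last n + 1 : Fin (n + 1)) = 0 := Fin.last_add_one n
  rw [hlast]
  exact key n (by omega)

/-- A set of edges is a forest if and only if each of its edges is a bridge. -/
theorem isForest_iff {V E : Type*} {G : Graph V E} {F : Set E} :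
    G.IsForest F ↔ F ⊆ G.edgeSet ∧
      ∀ e ∈ F, ∀ x y, G.IsLink e x y → ¬ G.Joined (F \ {e}) x y := by
  refine and_congr_right fun hF => ⟨fun h e he x y hl hj => ?_, fun h C hCF hC => ?_⟩
  · obtain ⟨C, hC, hcyc⟩ := Joined.exists_isCycleSet (e := e) (by simp) hl.symm hj
    exact h C (hC.trans (Set.insert_subset he Set.sdiff_subset)) hcyc
  · obtain ⟨e, he, x, y, hl, hj⟩ := hC.joined
    exact h e (hCF he) x y hl (hj.symm.mono (Set.sdiff_subset_sdiff_left hCF))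

theorem IsForest.insert {V E : Type*} {G : Graph V E} {F : Set E} (hF : G.IsForest F) {e : E}
    {x y : V} (hl : G.IsLink e x y) (hj : ¬ G.Joined F x y) : G.IsForest (insert e F) := by
  have heF : e ∉ F := fun h => hj (Relation.ReflTransGen.single ⟨e, h, hl⟩)
  refine ⟨Set.insert_subset hl.edge_mem hF.1, fun C hC hcyc => ?_⟩
  have hb := (isForest_iff.1 hF).2
  suffices h : G.IsForest (Insert.insert e F) from h.2 C hC hcyc
  refine isForest_iff.2 ⟨Set.insert_subset hl.edge_mem hF.1, ?_⟩
  rintro f (rfl | hf) a b hab hJ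
  · have hJ' : G.Joined F a b := hJ.mono (by intro; simp +contextual)
    rcases hab.eq_and_eq_or_eq_and_eq hl with ⟨rfl, rfl⟩ | ⟨rfl, rfl⟩
    · exact hj hJ'
    · exact hj hJ'.symm
  · have hsub : F \ {f} ⊆ F := Set.sdiff_subset
    have hfJ : G.Joined F a b := Relation.ReflTransGen.single ⟨f, hf, hab⟩
    have key : ∀ c, G.Joined (Insert.insert e F \ {f}) a c → G.Joined (F \ {f}) a c ∨
        (G.Joined (F \ {f}) a x ∧ G.Joined (F \ {f}) y c) ∨
        (G.Joined (F \ {f}) a y ∧ G.Joined (F \ {f}) x c) := by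
      intro c hc
      induction hc with
      | refl => exact Or.inl Relation.ReflTransGen.refl
      | @tail c d _ hcd ih =>
        obtain ⟨g, ⟨hg, hgf⟩, hgl⟩ := hcd
        rcases hg with rfl | hg
        · rcases hgl.eq_and_eq_or_eq_and_eq hl with ⟨rfl, rfl⟩ | ⟨rfl, rfl⟩
          · rcases ih with ih | ih | ih
            · exact Or.inr (Or.inl ⟨ih, Relation.ReflTransGen.refl⟩)
            · exact Or.inr (Or.inl ⟨ih.1, Relation.ReflTransGen.refl⟩)
            · exact Or.inl ih.1
          · rcases ih with ih | ih | ih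
            · exact Or.inr (Or.inr ⟨ih, Relation.ReflTransGen.refl⟩)
            · exact Or.inl ih.1
            · exact Or.inr (Or.inr ⟨ih.1, Relation.ReflTransGen.refl⟩)
        · have hs : G.Joined (F \ {f}) c d := Relation.ReflTransGen.single ⟨g, ⟨hg, hgf⟩, hgl⟩
          rcases ih with ih | ih | ih
          · exact Or.inl (ih.trans hs)
          · exact Or.inr (Or.inl ⟨ih.1, ih.2.trans hs⟩)
          · exact Or.inr (Or.inr ⟨ih.1, ih.2.trans hs⟩)
    rcases key b hJ with h | ⟨h1, h2⟩ | ⟨h1, h2⟩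
    · exact hb f hf a b hab h
    · exact hj ((h1.symm.mono hsub).trans (hfJ.trans (h2.symm.mono hsub)))
    · exact hj ((h2.mono hsub).trans (hfJ.symm.trans (h1.mono hsub)))

/-- The cycle matroid `M(G)` of a multigraph `G`: its ground set is the edge set of `G` and its
independent sets are the forests of `G`. -/
def cycleMatroid {V E : Type*} (G : Graph V E) : Matroid E :=
  (IndepMatroid.ofFinitary G.edgeSet G.IsForest
    ⟨Set.empty_subset _, by
      rintro C hC ⟨n, v, e, -, -, -, rfl⟩
      exact hC ⟨0, rfl⟩⟩
    (fun _ _ hJ hIJ => ⟨hIJ.trans hJ.1, fun C hC => hJ.2 C (hC.trans hIJ)⟩)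
    (by
      intro I B hI hImax hB
      by_contra! hcon
      have hIB : ∀ e ∈ B, ∀ x y, G.IsLink e x y → G.Joined I x y := by
        intro e he x y hl
        by_contra hj
        have heI : e ∉ I := fun h => hj (Relation.ReflTransGen.single ⟨e, h, hl⟩)
        exact hcon e ⟨he, heI⟩ (hI.insert hl hj)
      have hBI : ∀ x y, G.Joined B x y → G.Joined I x y := by
        intro x y h
        induction h with
        | refl => exact Relation.ReflTransGen.refl
        | tail _ h2 ih =>
          obtain ⟨e, he, hl⟩ := h2
          exact ih.trans (hIB e he _ _ hl)
      refine hImax ⟨hI, fun J hJ hIJ e heJ => ?_⟩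
      by_contra heI
      obtain ⟨x, y, hl⟩ := G.exists_isLink_of_mem_edgeSet (hJ.1 heJ)
      have hBxy : G.Joined B x y := by
        by_contra hj
        have h1 := hB.2 (hB.1.insert hl hj) (Set.subset_insert _ _) (Set.mem_insert _ _)
        exact hj (Relation.ReflTransGen.single ⟨e, h1, hl⟩)
      have hsub : I ⊆ J \ {e} := fun g hg => ⟨hIJ hg, fun h => heI (h ▸ hg)⟩
      exact (isForest_iff.1 hJ).2 e heJ x y hl ((hBI x y hBxy).mono hsub))
    (by
      intro I h
      refine ⟨fun e he => (h {e} (by simpa using he) (Set.finite_singleton e)).1 rfl, ?_⟩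
      intro C hC hcyc
      refine (h C hC ?_).2 C subset_rfl hcyc
      obtain ⟨n, v, e, -, -, -, rfl⟩ := hcyc
      exact Set.finite_range e)
    (fun _ h => h.1)).matroid

/-- `G` is obtained from `H` by contracting the edge `f`: delete `f` and identify its two ends. -/
def IsEdgeContraction {V E : Type*} (G H : Graph V E) (f : E) : Prop :=
  open Classical in
  ∃ x y, H.IsLink f x y ∧ G = (H.deleteEdges {f}).map (Function.update id y x)

/-- Series-parallel networks: the graphs obtained from a single loop or a single `K₂` by a sequence
of series and parallel extensions. -/
inductive IsSeriesParallelNetwork {V E : Type*} : Graph V E → Prop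
  /-- `G` has just one edge and no vertices but its ends: a loop if `x = y`, and `K₂` otherwise. -/
  | single {G : Graph V E} {e : E} {x y : V} (hl : G.IsLink e x y) (hE : G.edgeSet = {e})
      (hV : G.vertexSet = {x, y}) : IsSeriesParallelNetwork G
  /-- Parallel extension: `G = H \ f` where `f` is parallel to another edge `g` of `H`, that is,
  `f` and `g` are distinct non-loop edges with the same ends. -/
  | parallel {G H : Graph V E} {f g : E} {x y : V} (hG : IsSeriesParallelNetwork G)
      (hfg : f ≠ g) (hxy : x ≠ y) (hf : H.IsLink f x y) (hg : H.IsLink g x y)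
      (hGH : G = H.deleteEdges {f}) : IsSeriesParallelNetwork H
  /-- Series extension: `G = H / f` where `f` is in series with another edge `g` of `H`, that is,
  `{f, g}` is a bond (a cocircuit of the cycle matroid) of `H`. -/
  | series {G H : Graph V E} {f g : E} (hG : IsSeriesParallelNetwork G) (hfg : f ≠ g)
      (hser : H.cycleMatroid.IsCocircuit {f, g}) (hGH : G.IsEdgeContraction H f) :
      IsSeriesParallelNetwork H

end Graph

/-! ### Matroids -/

namespace Matroid

/-- The vector matroid on `E` of a family of vectors `v`: a subset of `E` is independent if and only
if the corresponding subfamily of `v` is linearly independent over `K`. -/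
def ofVectors (K : Type*) {W α : Type*} [Field K] [AddCommGroup W] [Module K W] (v : α → W)
    (E : Set α) : Matroid α :=
  (IndepMatroid.ofFinitary E (fun I => I ⊆ E ∧ LinearIndepOn K v I)
    ⟨Set.empty_subset _, linearIndepOn_empty K v⟩
    (fun _ _ hJ hIJ => ⟨hIJ.trans hJ.1, hJ.2.mono hIJ⟩)
    (by
      rintro I B ⟨hIE, hI⟩ hImax hB
      by_contra hno
      have hcon : ∀ e ∈ B \ I, ¬ (insert e I ⊆ E ∧ LinearIndepOn K v (insert e I)) :=
        fun e he h => hno ⟨e, he, h⟩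
      have hIB : v '' B ⊆ Submodule.span K (v '' I) := by
        rintro _ ⟨e, he, rfl⟩
        by_cases heI : e ∈ I
        · exact Submodule.subset_span ⟨e, heI, rfl⟩
        by_contra hsp
        exact hcon e ⟨he, heI⟩ ⟨Set.insert_subset (hB.1.1 he) hIE,
          (linearIndepOn_insert heI).2 ⟨hI, hsp⟩⟩
      refine hImax ⟨⟨hIE, hI⟩, fun J hJ hIJ e heJ => ?_⟩
      by_contra heI
      have h1 := hJ.2.mono (Set.insert_subset heJ hIJ)
      refine ((linearIndepOn_insert heI).1 h1).2 ?_
      refine Submodule.span_le.2 hIB ?_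
      by_cases heB : e ∈ B
      · exact Submodule.subset_span ⟨e, heB, rfl⟩
      by_contra hsp
      exact heB (hB.2 ⟨Set.insert_subset (hJ.1 heJ) hB.1.1,
        (linearIndepOn_insert heB).2 ⟨hB.1.2, hsp⟩⟩ (Set.subset_insert _ _) (Set.mem_insert _ _)))
    (by
      intro I h
      refine ⟨fun e he => (h {e} (by simpa using he) (Set.finite_singleton e)).1 rfl, ?_⟩
      exact linearIndepOn_iff_linearIndepOn_finset.2 fun t ht =>
        (h t ht t.finite_toSet).2)
    (fun _ h => h.1)).matroid

/-- `M` is binary: it is the vector matroid of a finite-dimensional family over `GF(2)`. -/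
def IsBinary {α : Type*} (M : Matroid α) : Prop :=
  ∃ (n : ℕ) (v : α → Fin n → ZMod 2), M = ofVectors (ZMod 2) v M.E

/-- `M` is simple: it has no loops (the case `e = f`) and no two distinct parallel elements. -/
def IsSimple {α : Type*} (M : Matroid α) : Prop :=
  ∀ e ∈ M.E, ∀ f ∈ M.E, M.Indep {e, f}

/-- `M` is connected: it has an element, and any two distinct elements lie in a common circuit. -/
def IsConnected {α : Type*} (M : Matroid α) : Prop :=
  M.E.Nonempty ∧ ∀ e ∈ M.E, ∀ f ∈ M.E, e ≠ f → ∃ C, M.IsCircuit C ∧ e ∈ C ∧ f ∈ C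

/-- `M` and `N` are isomorphic: some bijection of ground sets carries `M` to `N`. -/
def IsIsomorphic {α β : Type*} (M : Matroid α) (N : Matroid β) : Prop :=
  ∃ e : M.E ≃ N.E, M.mapSetEquiv e = N

/-- `N` is a simplification of `M`: it is obtained by deleting all the loops and all but one element
of each parallel class (two nonloops being parallel when they have the same closure). -/
def IsSimplificationOf {α : Type*} (N M : Matroid α) : Prop :=
  ∃ X : Set α, (∀ x ∈ X, M.IsNonloop x) ∧
    (∀ e, M.IsNonloop e → ∃! x, x ∈ X ∧ M.closure {x} = M.closure {e}) ∧ N = M.restrict X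

/-- `IsInducedMinorOf M N`: the matroid `N` is obtained from the simple matroid `M` by a sequence of
restrictions to flats and contractions, each contraction being followed by a simplification. -/
inductive IsInducedMinorOf {α : Type*} (M : Matroid α) : Matroid α → Prop
  | refl : IsInducedMinorOf M M
  | restrict {N : Matroid α} {F : Set α} (h : IsInducedMinorOf M N) (hF : N.IsFlat F) :
      IsInducedMinorOf M (N.restrict F)
  | contract {N N' : Matroid α} {C : Set α} (h : IsInducedMinorOf M N) (hC : C ⊆ N.E)
      (hN' : N'.IsSimplificationOf (N.contract C)) : IsInducedMinorOf M N'

/-- `M` has an induced minor isomorphic to `N`. -/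
def HasInducedMinor {α β : Type*} (M : Matroid α) (N : Matroid β) : Prop :=
  ∃ M' : Matroid α, M.IsInducedMinorOf M' ∧ M'.IsIsomorphic N

/-- The cycle matroid `M(K₄)` of the complete graph on four vertices. -/
def cycleK4 : Matroid (Sym2 (Fin 4)) :=
  (Graph.ofSimpleGraph (⊤ : SimpleGraph (Fin 4))).cycleMatroid

/-- The Fano matroid `F₇`: all the nonzero vectors of `GF(2)³` under linear independence. -/
def fano : Matroid (Fin 3 → ZMod 2) :=
  ofVectors (ZMod 2) id {x | x ≠ 0}

/-- `M` is a series-parallel network: it is the cycle matroid of a graph that is one. -/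
def IsSeriesParallelNetwork {α : Type*} (M : Matroid α) : Prop :=
  ∃ (V : Type) (G : Graph V α), G.IsSeriesParallelNetwork ∧ M = G.cycleMatroid

end Matroid

/-! ### Vector matroids -/

/-! Both directions pass through one linear-algebraic condition on a set `S` of vectors over
`GF(2)`, `HasK4Projection S`: some linear map onto the coordinates of `GF(2)³` hits all nonzero
vectors except at most one, and its kernel inside the span of `S` is spanned by elements of `S`. The
kernel condition says that the map realises the contraction of the elements it kills. Simplifying
that contraction leaves `F₇`, or `F₇` minus a point, which is `M(K₄)` whichever point is missing
(`hasInducedMinor_of_hasK4Projection`). Conversely, a minor that is simple of rank three with at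
least six elements yields such a map (`HasK4Projection.of_isMinor`). So excluding the two induced
minors amounts to excluding a projection.

Suppose there is no projection. Fix a basis among the vectors and form the bipartite fundamental
graph between basis and non-basis elements. An induced domino or an induced cycle of length at least
six would each give a projection, so the graph has neither. A bipartite graph of this kind with an
edge has a pendant vertex or a pair of twins (`SimpleGraph.exists_pendant_or_twins`; these are the
bipartite distance-hereditary graphs), and either one is a parallel or a series pair of the matroid
(`exists_series_or_parallel_pair`). Deleting an element of a parallel pair, or contracting an
element of a series pair, preserves connectedness and the absence of projections, so induction gives
a graph for the smaller matroid. Doubling or subdividing an edge of that graph gives one for the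
original, because a matroid is determined by the pair together with the deletion or contraction
(`eq_of_delete_eq_of_isCircuit` and its dual).

For the converse, follow the construction of a series-parallel network, representing edges by
incidence vectors. Connectedness lifts along both extensions. A parallel extension does not change
the set of vectors, and `HasK4Projection.image_transvection` shows that a projection survives the
contraction of one element of a series pair, so a series extension cannot create one. -/

/-- Dependence of the images is decided by which combinations are killed, and all combinations lie
in `U`. This lets a quotient map be replaced by any other map with the same kernel on the relevant
span. -/
theorem linearIndepOn_comp_congr_of_inf_ker_eq {K W W₁ W₂ α : Type*} [Field K] [AddCommGroup W]
    [Module K W] [AddCommGroup W₁] [Module K W₁] [AddCommGroup W₂] [Module K W₂] {v : α → W}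
    {J : Set α} {L₁ : W →ₗ[K] W₁} {L₂ : W →ₗ[K] W₂} {U : Submodule K W} (hU : ∀ e ∈ J, v e ∈ U)
    (h : ∀ w ∈ U, L₁ w = 0 ↔ L₂ w = 0) :
    LinearIndepOn K (L₁ ∘ v) J ↔ LinearIndepOn K (L₂ ∘ v) J := by
  rw [linearIndepOn_iff, linearIndepOn_iff]
  refine forall₂_congr fun l hl => ?_
  have hmem : Finsupp.linearCombination K v l ∈ U := by
    rw [Finsupp.linearCombination_apply]
    exact Submodule.sum_mem _ fun e he => U.smul_mem _ (hU e (hl he))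
  rw [← LinearMap.map_finsupp_linearCombination, ← LinearMap.map_finsupp_linearCombination,
    h _ hmem]

namespace Matroid

section Vectors

variable {K W W' α : Type*} [Field K] [AddCommGroup W] [Module K W] [AddCommGroup W'] [Module K W']
  {v : α → W} {E : Set α}

@[simp] theorem ofVectors_ground (v : α → W) (E : Set α) : (ofVectors K v E).E = E := rfl

theorem ofVectors_indep_iff {I : Set α} :
    (ofVectors K v E).Indep I ↔ I ⊆ E ∧ LinearIndepOn K v I := Iff.rfl

theorem ofVectors_congr {v w : α → W} (h : Set.EqOn v w E) : ofVectors K v E = ofVectors K w E := by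
  refine ext_indep rfl fun I hI => ?_
  rw [ofVectors_indep_iff, ofVectors_indep_iff, linearIndepOn_congr (h.mono hI)]

theorem ofVectors_restrict {X : Set α} (hX : X ⊆ E) :
    (ofVectors K v E).restrict X = ofVectors K v X := by
  refine ext_indep rfl fun I hI => ?_
  rw [restrict_indep_iff, ofVectors_indep_iff, ofVectors_indep_iff]
  have hI' : I ⊆ X := hI
  simp [hI', hI'.trans hX]

theorem ofVectors_comp {L : W →ₗ[K] W'} (hL : ∀ w ∈ Submodule.span K (v '' E), L w = 0 → w = 0) :
    ofVectors K (L ∘ v) E = ofVectors K v E := by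
  refine ext_indep rfl fun I hI => ?_
  rw [ofVectors_indep_iff, ofVectors_indep_iff]
  refine and_congr_right fun _ => ?_
  refine linearIndepOn_comp_congr_of_inf_ker_eq (L₂ := LinearMap.id)
    (U := Submodule.span K (v '' E)) (fun e he => Submodule.subset_span ⟨e, hI he, rfl⟩) ?_
  exact fun w hw => ⟨hL w hw, by rintro h; simp_all⟩

theorem ofVectors_span_of_isBasis {I X : Set α} (h : (ofVectors K v E).IsBasis I X) :
    Submodule.span K (v '' I) = Submodule.span K (v '' X) := by
  refine le_antisymm (Submodule.span_mono (Set.image_mono h.subset)) (Submodule.span_le.2 ?_)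
  rintro _ ⟨x, hx, rfl⟩
  by_contra hsp
  have hxI : x ∉ I := fun hxI => hsp (Submodule.subset_span ⟨x, hxI, rfl⟩)
  refine hxI (h.mem_of_insert_indep hx (ofVectors_indep_iff.2 ⟨?_, ?_⟩))
  · exact Set.insert_subset (h.subset_ground hx) (h.subset.trans h.subset_ground)
  · exact (linearIndepOn_insert hxI).2 ⟨h.indep.2, hsp⟩

/-- Only the kernel of `L` on the span of the family matters. The lemma is applied to quotient maps,
to rank-one projections that stay in `W`, and to the maps of `HasK4Projection`. -/
theorem ofVectors_contract {C : Set α} (hC : C ⊆ E) {L : W →ₗ[K] W'}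
    (hL : ∀ w ∈ Submodule.span K (v '' E), L w = 0 ↔ w ∈ Submodule.span K (v '' C)) :
    (ofVectors K v E).contract C = ofVectors K (L ∘ v) (E \ C) := by
  refine ext_indep rfl fun J hJ => ?_
  obtain ⟨hJE, hJC⟩ := Set.subset_sdiff.1 hJ
  obtain ⟨I, hI⟩ := (ofVectors K v E).exists_isBasis C hC
  rw [hI.contract_indep_iff_of_disjoint hJC.symm, ofVectors_indep_iff, ofVectors_indep_iff,
    Set.union_comm, ← hI.indep.2.quotient_iff_union (hJC.symm.mono_left hI.subset)]
  rw [and_iff_right (Set.union_subset hI.indep.1 hJE), and_iff_right (show J ⊆ E \ C from hJ),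
    ofVectors_span_of_isBasis hI]
  refine linearIndepOn_comp_congr_of_inf_ker_eq
    (U := Submodule.span K (v '' E)) (fun e he => Submodule.subset_span ⟨e, hJE he, rfl⟩) ?_
  intro w hw
  rw [hL w hw, Submodule.mkQ_apply, Submodule.Quotient.mk_eq_zero]

theorem mem_ofVectors_closure_iff {X : Set α} (hX : X ⊆ E) {e : α} :
    e ∈ (ofVectors K v E).closure X ↔ e ∈ E ∧ v e ∈ Submodule.span K (v '' X) := by
  obtain ⟨I, hI⟩ := (ofVectors K v E).exists_isBasis X hX
  rw [← hI.closure_eq_closure, hI.indep.mem_closure_iff', ← ofVectors_span_of_isBasis hI]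
  refine and_congr_right fun heE => ?_
  by_cases heI : e ∈ I
  · simpa [heI] using Submodule.subset_span (Set.mem_image_of_mem v heI)
  · rw [ofVectors_indep_iff, linearIndepOn_insert heI]
    have h1 : insert e I ⊆ E := Set.insert_subset heE hI.indep.1
    have h2 : LinearIndepOn K v I := hI.indep.2
    simp [h1, h2, heI]

theorem ofVectors_spanning_iff {X : Set α} (hX : X ⊆ E) :
    (ofVectors K v E).Spanning X ↔ ∀ e ∈ E, v e ∈ Submodule.span K (v '' X) := by
  rw [spanning_iff_ground_subset_closure hX]
  refine forall₂_congr fun e he => ?_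
  rw [mem_ofVectors_closure_iff hX, and_iff_right (show e ∈ E from he)]

theorem ofVectors_isLoop_iff {e : α} (he : e ∈ E) : (ofVectors K v E).IsLoop e ↔ v e = 0 := by
  rw [← singleton_dep, dep_iff, ofVectors_indep_iff, linearIndepOn_singleton_iff]
  simp [he]

theorem ofVectors_isColoop_iff {e : α} (he : e ∈ E) :
    (ofVectors K v E).IsColoop e ↔ v e ∉ Submodule.span K (v '' (E \ {e})) := by
  rw [isColoop_iff_notMem_closure_compl he, ofVectors_ground,
    mem_ofVectors_closure_iff Set.sdiff_subset, and_iff_right he]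

end Vectors

/-! ### Parallel and series pairs over `GF(2)` -/

section Binary

variable {W α : Type*} [AddCommGroup W] [Module (ZMod 2) W] {v : α → W} {E : Set α}

theorem ofVectors_parallel {e f : α} (he : e ∈ E) (hf : f ∈ E) (hef : e ≠ f) (h : v e = v f)
    (h0 : v e ≠ 0) : (ofVectors (ZMod 2) v E).IsCircuit {e, f} := by
  rw [isCircuit_iff_dep_forall_sdiff_singleton_indep, dep_iff, ofVectors_indep_iff]
  refine ⟨⟨fun hi => ?_, Set.pair_subset he hf⟩, ?_⟩
  · exact hef (hi.2.injOn (by simp) (by simp) h)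
  · rintro g (rfl | rfl)
    · rw [Set.pair_sdiff_left hef, ofVectors_indep_iff, linearIndepOn_singleton_iff, ← h]
      exact ⟨by simpa using hf, h0⟩
    · rw [Set.pair_sdiff_right hef, ofVectors_indep_iff, linearIndepOn_singleton_iff]
      exact ⟨by simpa using he, h0⟩

/-- The kernel of `l` contains every element but `e` and `f`, so the complement of the pair does not
span. The pair is minimal with this property because neither element is a coloop. -/
theorem ofVectors_isCocircuit_pair {e f : α} (he : e ∈ E) (hf : f ∈ E) (hef : e ≠ f)
    (hce : ¬ (ofVectors (ZMod 2) v E).IsColoop e) {l : W →ₗ[ZMod 2] ZMod 2} (hle : l (v e) = 1)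
    (hlf : l (v f) = 1) (hl : ∀ g ∈ E, g ≠ e → g ≠ f → l (v g) = 0) :
    (ofVectors (ZMod 2) v E).IsCocircuit {e, f} := by
  have hcf : ¬ (ofVectors (ZMod 2) v E).IsColoop f := by
    rw [ofVectors_isColoop_iff hf]
    intro hcf
    -- If `f` were a coloop, some `l'` would detect `f` alone; then `l + l'` would detect `e` alone,
    -- making `e` a coloop.
    obtain ⟨l', hl'f, hl'⟩ := Submodule.exists_le_ker_of_notMem hcf
    have h01 : ∀ c : ZMod 2, c ≠ 0 → 1 + c = 0 := by decide
    have hzero : ∀ g ∈ E, g ≠ f → l' (v g) = 0 := fun g hg hgf =>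
      hl' (Submodule.subset_span ⟨g, ⟨hg, hgf⟩, rfl⟩)
    refine hce ((ofVectors_isColoop_iff he).2 fun hsp => ?_)
    have h1 : Submodule.span (ZMod 2) (v '' (E \ {e})) ≤ LinearMap.ker (l + l') := by
      rw [Submodule.span_le]
      rintro _ ⟨g, ⟨hg, hge⟩, rfl⟩
      by_cases hgf : g = f
      · simp [hgf, hlf, h01 _ hl'f]
      · simp [hl g hg hge hgf, hzero g hg hgf]
    have h2 := h1 hsp
    rw [LinearMap.mem_ker, LinearMap.add_apply, hle, hzero e he hef, add_zero] at h2
    exact one_ne_zero h2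
  rw [isCocircuit_iff_minimal_compl_nonspanning, Set.minimal_iff_forall_ssubset]
  refine ⟨fun hsp => ?_, fun X hX => not_not.2 ?_⟩
  · have h1 := (ofVectors_spanning_iff Set.sdiff_subset).1 hsp e he
    have h2 : Submodule.span (ZMod 2) (v '' ((ofVectors (ZMod 2) v E).E \ {e, f})) ≤
        LinearMap.ker l := by
      rw [Submodule.span_le]
      rintro _ ⟨g, ⟨hg, hgef⟩, rfl⟩
      exact hl g hg (fun h => hgef (by simp [h])) (fun h => hgef (by simp [h]))
    have h3 : l (v e) = 0 := h2 h1
    rw [hle] at h3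
    exact one_ne_zero h3
  · have hX' : X ⊆ {e} ∨ X ⊆ {f} := by
      by_contra! hcon
      obtain ⟨⟨a, ha, hae⟩, ⟨b, hb, hbf⟩⟩ := And.imp Set.not_subset.1 Set.not_subset.1 hcon
      have ha' : a = f := (hX.1 ha).resolve_left hae
      have hb' : b = e := (hX.1 hb).resolve_right hbf
      exact hX.2 (Set.pair_subset (hb' ▸ hb) (ha' ▸ ha))
    rcases hX' with h | h
    · rw [isColoop_iff_sdiff_not_spanning, not_not] at hce
      exact hce.superset (Set.sdiff_subset_sdiff_right h)
    · rw [isColoop_iff_sdiff_not_spanning, not_not] at hcf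
      exact hcf.superset (Set.sdiff_subset_sdiff_right h)

theorem exists_functional_of_isCocircuit_pair {e f : α}
    (hef : (ofVectors (ZMod 2) v E).IsCocircuit {e, f}) (hne : e ≠ f) :
    ∃ l : W →ₗ[ZMod 2] ZMod 2, l (v e) = 1 ∧ l (v f) = 1 ∧
      ∀ g ∈ E, g ≠ e → g ≠ f → l (v g) = 0 := by
  have heE : e ∈ E := hef.subset_ground (by simp)
  have hfE : f ∈ E := hef.subset_ground (by simp)
  have hnc : ∀ g ∈ ({e, f} : Set α), v g ∈ Submodule.span (ZMod 2) (v '' (E \ {g})) := by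
    intro g hg
    by_contra hcon
    rw [← ofVectors_isColoop_iff (show g ∈ E from hef.subset_ground hg)] at hcon
    have h1 := hef.eq_of_superset_isCircuit hcon.isCocircuit (by simpa using hg)
    rw [Set.eq_singleton_iff_unique_mem] at h1
    exact hne ((h1.2 e (by simp)).trans (h1.2 f (by simp)).symm)
  obtain ⟨g, hg, hgU⟩ : ∃ g ∈ ({e, f} : Set α),
      v g ∉ Submodule.span (ZMod 2) (v '' (E \ {e, f})) := by
    by_contra! hcon
    rw [isCocircuit_iff_minimal_compl_nonspanning] at hef
    refine hef.prop ((ofVectors_spanning_iff Set.sdiff_subset).2 fun g hg => ?_)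
    by_cases hg' : g ∈ ({e, f} : Set α)
    · exact hcon g hg'
    · exact Submodule.subset_span ⟨g, ⟨hg, hg'⟩, rfl⟩
  obtain ⟨l, hlg, hl⟩ := Submodule.exists_le_ker_of_notMem hgU
  have hl' : ∀ x ∈ E, x ≠ e → x ≠ f → l (v x) = 0 := fun x hx hxe hxf =>
    hl (Submodule.subset_span ⟨x, ⟨hx, by simp [hxe, hxf]⟩, rfl⟩)
  have h01 : ∀ c : ZMod 2, c ≠ 0 → c = 1 := by decide
  -- If `l` vanished at the other element of the pair, it would vanish on everything but `g`, hence
  -- also at `g`, which is spanned by the rest.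
  have key : ∀ x ∈ ({e, f} : Set α), l (v x) ≠ 0 := by
    intro x hx hx0
    have hxg : x ≠ g := by rintro rfl; exact hlg hx0
    have h2 : Submodule.span (ZMod 2) (v '' (E \ {g})) ≤ LinearMap.ker l := by
      rw [Submodule.span_le]
      rintro _ ⟨y, ⟨hy, hyg⟩, rfl⟩
      by_cases hyx : y = x
      · subst hyx; exact hx0
      · refine hl' y hy ?_ ?_ <;> rintro rfl <;> grind
    exact hlg (h2 (hnc g hg))
  exact ⟨l, h01 _ (key e (by simp)), h01 _ (key f (by simp)), hl'⟩

end Binary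

end Matroid

/-! ### Incidence vectors of graphs -/

namespace Graph

variable {V E : Type*}

open Classical in
/-- The vector over `GF(2)` with ones at the ends of a non-loop edge; it vanishes for loops. -/
noncomputable def incVec (G : Graph V E) (e : E) : V →₀ ZMod 2 :=
  if h : ∃ p : V × V, G.IsLink e p.1 p.2 then
    Finsupp.single h.choose.1 1 + Finsupp.single h.choose.2 1
  else 0

theorem IsLink.incVec_eq {G : Graph V E} {e : E} {x y : V} (h : G.IsLink e x y) :
    G.incVec e = Finsupp.single x 1 + Finsupp.single y 1 := by
  have hex : ∃ p : V × V, G.IsLink e p.1 p.2 := ⟨(x, y), h⟩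
  rw [incVec, dif_pos hex]
  rcases h.eq_and_eq_or_eq_and_eq hex.choose_spec with ⟨h1, h2⟩ | ⟨h1, h2⟩
  · rw [← h1, ← h2]
  · rw [← h1, ← h2, add_comm]

theorem single_add_single_self (x : V) :
    (Finsupp.single x 1 + Finsupp.single x 1 : V →₀ ZMod 2) = 0 := by
  rw [← Finsupp.single_add, show (1 + 1 : ZMod 2) = 0 from rfl, Finsupp.single_zero]

theorem joined_iff_mem_span {G : Graph V E} {F : Set E} {x y : V} :
    G.Joined F x y ↔ Finsupp.single x 1 + Finsupp.single y 1 ∈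
      Submodule.span (ZMod 2) (G.incVec '' F) := by
  classical
  constructor
  · intro h
    induction h with
    | refl => rw [single_add_single_self]; exact Submodule.zero_mem _
    | @tail b c _ hbc ih =>
      obtain ⟨e, he, hl⟩ := hbc
      have h1 : G.incVec e ∈ Submodule.span (ZMod 2) (G.incVec '' F) :=
        Submodule.subset_span ⟨e, he, rfl⟩
      rw [hl.incVec_eq] at h1
      have h2 := Submodule.add_mem _ ih h1
      rwa [add_assoc, ← add_assoc (Finsupp.single b 1), single_add_single_self, zero_add] at h2
  · intro h
    -- `φ` adds up the coordinates in the component of `x`. It kills every edge of `F`, but not `x +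
    -- y` if `y` lies in another component.
    let φ : (V →₀ ZMod 2) →ₗ[ZMod 2] ZMod 2 :=
      Finsupp.linearCombination (ZMod 2) (fun z => if G.Joined F x z then 1 else 0)
    have h1 : Submodule.span (ZMod 2) (G.incVec '' F) ≤ LinearMap.ker φ := by
      rw [Submodule.span_le]
      rintro _ ⟨e, he, rfl⟩
      by_cases hE : e ∈ G.edgeSet
      · obtain ⟨a, b, hab⟩ := G.exists_isLink_of_mem_edgeSet hE
        have hiff : G.Joined F x a ↔ G.Joined F x b :=
          ⟨fun h => h.tail ⟨e, he, hab⟩, fun h => h.tail ⟨e, he, hab.symm⟩⟩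
        simp only [SetLike.mem_coe, LinearMap.mem_ker, hab.incVec_eq, φ, map_add,
          Finsupp.linearCombination_single, hiff]
        split_ifs <;> decide
      · have : G.incVec e = 0 := by
          rw [incVec, dif_neg]
          rintro ⟨p, hp⟩
          exact hE hp.edge_mem
        simp [this]
    have h2 := h1 h
    have hx : G.Joined F x x := Relation.ReflTransGen.refl
    simp only [LinearMap.mem_ker, φ, map_add, Finsupp.linearCombination_single, hx, if_true] at h2
    by_contra hy
    simp [hy] at h2

/-- A forest is a set in which each edge is a bridge, and an edge is a bridge when its incidence
vector is not in the span of the others. -/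
theorem cycleMatroid_eq_ofVectors (G : Graph V E) :
    G.cycleMatroid = Matroid.ofVectors (ZMod 2) G.incVec G.edgeSet := by
  refine Matroid.ext_indep rfl fun I hI => ?_
  change G.IsForest I ↔ I ⊆ G.edgeSet ∧ _
  rw [isForest_iff]
  refine and_congr_right fun hIE => ?_
  rw [linearIndepOn_iff_notMem_span]
  refine forall₂_congr fun e he => ?_
  obtain ⟨a, b, hab⟩ := G.exists_isLink_of_mem_edgeSet (hIE he)
  rw [hab.incVec_eq, ← joined_iff_mem_span]
  constructor
  · exact fun h => h a b hab
  · intro h x y hl hj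
    rcases hl.eq_and_eq_or_eq_and_eq hab with ⟨rfl, rfl⟩ | ⟨rfl, rfl⟩
    · exact h hj
    · exact h hj.symm

end Graph

/-! ### Connectivity under series and parallel extensions -/

namespace Matroid

variable {α : Type*} {M : Matroid α} {e f : α}

theorem IsConnected.not_isLoop (h : M.IsConnected) (hf : f ∈ M.E) (hef : e ≠ f) :
    ¬ M.IsLoop e := by
  intro he
  obtain ⟨C, hC, heC, hfC⟩ := h.2 e he.mem_ground f hf hef
  have := hC.eq_of_superset_isCircuit he.isCircuit (by simpa using heC)
  rw [this] at hfC
  exact hef hfC.symm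

theorem IsConnected.not_isColoop (h : M.IsConnected) (hf : f ∈ M.E) (hef : e ≠ f) :
    ¬ M.IsColoop e := by
  intro he
  obtain ⟨C, hC, heC, hfC⟩ := h.2 e he.mem_ground f hf hef
  exact he.notMem_isCircuit hC heC

/-- If `D` missed `f` it would be a circuit inside `C`, hence equal to `C`, although it avoids `e`.
Eliminating one element of a parallel pair thus always brings in the other. -/
theorem IsCircuit.mem_of_exchange {C D : Set α} (hC : M.IsCircuit C) (hD : M.IsCircuit D)
    (hDC : D ⊆ (C ∪ {e, f}) \ {e}) (heC : e ∈ C) : f ∈ D := by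
  by_contra hfD
  have hsub : D ⊆ C := by
    intro x hx
    rcases (hDC hx).1 with h | rfl | rfl
    · exact h
    · exact heC
    · exact absurd hx hfD
  exact (hDC ((hD.eq_of_subset_isCircuit hC hsub) ▸ heC)).2 rfl

theorem IsConnected.of_delete_parallel (hef : M.IsCircuit {e, f}) (hne : e ≠ f)
    (h : (M.delete {f}).IsConnected) : M.IsConnected := by
  have heE : e ∈ M.E := hef.subset_ground (by simp)
  have hfE : f ∈ M.E := hef.subset_ground (by simp)
  refine ⟨⟨e, heE⟩, ?_⟩
  have key : ∀ b ∈ M.E, b ≠ f → ∃ C, M.IsCircuit C ∧ f ∈ C ∧ b ∈ C := by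
    intro b hb hbf
    by_cases hbe : b = e
    · exact ⟨_, hef, by simp, by simp [hbe]⟩
    obtain ⟨C, hC, heC, hbC⟩ := h.2 e ⟨heE, hne⟩ b ⟨hb, hbf⟩ (Ne.symm hbe)
    rw [delete_isCircuit_iff] at hC
    obtain ⟨D, hD, hDC, hbD⟩ := hC.1.strong_elimination hef heC (by simp) hbC (by simp [hbe, hbf])
    exact ⟨D, hDC, hC.1.mem_of_exchange hDC hD heC, hbD⟩
  intro a ha b hb hab
  by_cases haf : a = f
  · subst haf
    exact key b hb hab.symm
  by_cases hbf : b = f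
  · subst hbf
    obtain ⟨C, hC, h1, h2⟩ := key a ha hab
    exact ⟨C, hC, h2, h1⟩
  obtain ⟨C, hC, h1, h2⟩ := h.2 a ⟨ha, haf⟩ b ⟨hb, hbf⟩ hab
  exact ⟨C, hC.of_delete, h1, h2⟩

/-- A circuit through `a` and `b` that uses `f` cannot use `e`, so `f` can be traded for `e` by
elimination against `{e, f}`. -/
theorem IsConnected.delete_parallel (h : M.IsConnected) (hef : M.IsCircuit {e, f}) (hne : e ≠ f) :
    (M.delete {f}).IsConnected := by
  have heE : e ∈ M.E := hef.subset_ground (by simp)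
  refine ⟨⟨e, heE, hne⟩, ?_⟩
  rintro a ⟨ha, haf⟩ b ⟨hb, hbf⟩ hab
  obtain ⟨C, hC, haC, hbC⟩ := h.2 a ha b hb hab
  simp only [delete_isCircuit_iff, Set.disjoint_singleton_right]
  by_cases hfC : f ∈ C
  swap
  · exact ⟨C, ⟨hC, hfC⟩, haC, hbC⟩
  have heC : e ∉ C := by
    intro heC
    have h1 := hef.eq_of_subset_isCircuit hC (Set.pair_subset heC hfC)
    rw [← h1] at haC hbC
    exact hab ((haC.resolve_right haf).trans (hbC.resolve_right hbf).symm)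
  have hfe : M.IsCircuit {f, e} := by rwa [Set.pair_comm]
  have hae : a ≠ e := fun h => heC (h ▸ haC)
  have hbe : b ≠ e := fun h => heC (h ▸ hbC)
  obtain ⟨D, hDC, hD, haD⟩ :=
    hC.strong_elimination hfe hfC (by simp) haC (by rintro (h | h); exacts [haf h, hae h])
  have heD := hC.mem_of_exchange hD hDC hfC
  refine ⟨D, ⟨hD, fun hfD => (hDC hfD).2 rfl⟩, haD, ?_⟩
  by_contra hbD
  -- Strong elimination keeps only `a` for certain. To see that `b` also survives, trade `e` back
  -- for `f`: the result lies in `C`, so it is `C` and contains `b`.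
  obtain ⟨D', hDC', hD', haD'⟩ :=
    hD.strong_elimination hef heD (by simp) haD (by rintro (h | h); exacts [hae h, haf h])
  have hsub : D' ⊆ C := by
    intro x hx
    obtain ⟨h1 | h1, h2⟩ := hDC' hx
    · obtain ⟨h3 | h3 | h3, h4⟩ := hDC h1
      · exact h3
      · exact absurd h3 h4
      · exact absurd h3 h2
    · rcases h1 with h1 | h1
      · exact absurd h1 h2
      · exact h1 ▸ hfC
  have hbD' : b ∈ D' := (hD'.eq_of_subset_isCircuit hC hsub) ▸ hbC
  obtain ⟨h1 | h1 | h1, -⟩ := hDC' hbD'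
  · exact hbD h1
  · exact hbe h1
  · exact hbf h1

/-- Orthogonality: a circuit and a cocircuit never meet in exactly one element. -/
theorem IsCircuit.mem_of_series {C : Set α} (hC : M.IsCircuit C) (hef : M.IsCocircuit {e, f})
    (heC : e ∈ C) : f ∈ C := by
  by_contra hfC
  refine hC.inter_isCocircuit_ne_singleton hef (e := e) ?_
  ext x
  simp only [Set.mem_inter_iff, Set.mem_insert_iff, Set.mem_singleton_iff]
  refine ⟨?_, fun h => ⟨h ▸ heC, Or.inl h⟩⟩
  rintro ⟨h1, h2 | h2⟩
  · exact h2
  · exact absurd (h2 ▸ h1) hfC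

theorem IsConnected.contract_series (h : M.IsConnected) (hef : M.IsCocircuit {e, f})
    (hne : e ≠ f) : (M.contract {f}).IsConnected := by
  have heE : e ∈ M.E := hef.subset_ground (by simp)
  refine ⟨⟨e, heE, hne⟩, ?_⟩
  rintro a ⟨ha, haf⟩ b ⟨hb, hbf⟩ hab
  obtain ⟨C, hC, haC, hbC⟩ := h.2 a ha b hb hab
  by_cases hfC : f ∈ C
  · exact ⟨C \ {f}, hC.contractElem_isCircuit ⟨a, haC, b, hbC, hab⟩ hfC, ⟨haC, haf⟩, ⟨hbC, hbf⟩⟩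
  · obtain ⟨D, hDC, hD⟩ :=
      (hC.contract_dep (C := {f}) (by simpa using hfC)).exists_isCircuit_subset
    obtain ⟨C', hC', hDC', hC'D⟩ := hD.exists_subset_isCircuit_of_contract
    have hfe : M.IsCocircuit {f, e} := by rwa [Set.pair_comm]
    -- A circuit of `M` through `f` also uses `e`; then `e` would lie in `D ⊆ C` and force `f` into
    -- `C`. Hence `C'`, `D` and `C` coincide.
    have hfC' : f ∉ C' := fun hf => by
      rcases hC'D (hC'.mem_of_series hfe hf) with h1 | h1
      · exact hfC (hC.mem_of_series hef (hDC h1))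
      · exact hne h1
    have hC'D' : C' ⊆ D := fun x hx => (hC'D hx).resolve_right fun h => hfC' (h ▸ hx)
    have h1 : C' = C := hC'.eq_of_subset_isCircuit hC (hC'D'.trans hDC)
    have h2 : D = C := Set.Subset.antisymm hDC (h1 ▸ hC'D')
    exact ⟨D, hD, h2 ▸ haC, h2 ▸ hbC⟩

theorem IsConnected.of_contract_series (hef : M.IsCocircuit {e, f}) (hne : e ≠ f)
    (h : (M.contract {f}).IsConnected) : M.IsConnected := by
  have heE : e ∈ M.E := hef.subset_ground (by simp)
  have hfE : f ∈ M.E := hef.subset_ground (by simp)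
  refine ⟨⟨e, heE⟩, ?_⟩
  have key : ∀ b ∈ M.E, b ≠ f → ∃ C, M.IsCircuit C ∧ f ∈ C ∧ b ∈ C := by
    intro b hb hbf
    obtain ⟨D, hD, heD, hbD⟩ : ∃ D, (M.contract {f}).IsCircuit D ∧ e ∈ D ∧ b ∈ D := by
      by_cases hbe : b = e
      · subst hbe
        -- Connectedness gives a circuit only through two distinct elements, so `b = e` needs its
        -- own argument: without a circuit through `e` it would be a coloop of `M`, and `{e}` a
        -- cocircuit properly inside `{e, f}`.
        by_contra! hcon
        have h1 : (M.contract {f}).IsColoop b :=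
          (isColoop_iff_forall_notMem_isCircuit (show b ∈ M.E \ {f} from ⟨hb, hne⟩)).2
            fun C hC hbC => hcon C hC hbC hbC
        have h2 := ((contract_isColoop_iff).1 h1).1
        have h3 := hef.eq_of_superset_isCircuit h2.isCocircuit (by simp)
        have h4 : f ∈ ({b} : Set α) := h3 ▸ (by simp)
        exact hne h4.symm
      · exact h.2 e ⟨heE, hne⟩ b ⟨hb, hbf⟩ (Ne.symm hbe)
    obtain ⟨C, hC, hDC, -⟩ := hD.exists_subset_isCircuit_of_contract
    exact ⟨C, hC, hC.mem_of_series hef (hDC heD), hDC hbD⟩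
  intro a ha b hb hab
  by_cases haf : a = f
  · subst haf
    exact key b hb hab.symm
  by_cases hbf : b = f
  · subst hbf
    obtain ⟨C, hC, h1, h2⟩ := key a ha hab
    exact ⟨C, hC, h2, h1⟩
  obtain ⟨C, hC, h1, h2⟩ := h.2 a ⟨ha, haf⟩ b ⟨hb, hbf⟩ hab
  obtain ⟨C', hC', hsub, -⟩ := hC.exists_subset_isCircuit_of_contract
  exact ⟨C', hC', hsub h1, hsub h2⟩

/-- Circuits avoiding `f` are those of the deletion, and a circuit through `f` other than the pair
can be traded for one through `e` instead. A circuit of `N` inside an `M`-independent set is moved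
off `f` in `N`, read in `M`, and moved back in `M`, which gives a contradiction. -/
theorem eq_of_delete_eq_of_isCircuit {N : Matroid α} (hM : M.IsCircuit {e, f})
    (hN : N.IsCircuit {e, f}) (h : M.delete {f} = N.delete {f}) : M = N := by
  have aux : ∀ {M N : Matroid α}, M.IsCircuit {e, f} → N.IsCircuit {e, f} →
      M.delete {f} = N.delete {f} → ∀ I, M.Indep I → N.Indep I := by
    intro M N hM hN h I hI
    by_contra hcon
    have hdel : ∀ J, f ∉ J → (M.Indep J ↔ N.Indep J) := fun J hJ => by
      have h1 : (M.delete {f}).Indep J ↔ (N.delete {f}).Indep J := by rw [h]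
      simpa [deleteElem_indep_iff, hJ] using h1
    have hE : M.E \ {f} = N.E \ {f} := congrArg Matroid.E h
    have hIE : I ⊆ N.E := by
      intro x hx
      by_cases hxf : x = f
      · exact hN.subset_ground (by simp [hxf])
      · exact (hE ▸ (⟨hI.subset_ground hx, hxf⟩ : x ∈ M.E \ {f}) : x ∈ N.E \ {f}).1
    obtain ⟨C, hCI, hC⟩ := ((not_indep_iff hIE).1 hcon).exists_isCircuit_subset
    by_cases hfC : f ∈ C
    swap
    · exact hC.not_indep ((hdel C hfC).1 (hI.subset hCI))
    have hCM : M.Indep C := hI.subset hCI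
    have heC : e ∉ C := fun heC => hM.not_indep (hCM.subset (Set.pair_subset heC hfC))
    by_cases hCf : C = {f}
    · have h1 := hN.eq_of_superset_isCircuit hC (by simp [hCf])
      exact heC (h1 ▸ Set.mem_insert e {f})
    obtain ⟨b, hb, hbf⟩ : ∃ b ∈ C, b ≠ f := by
      by_contra! hb
      exact hCf (Set.eq_singleton_iff_unique_mem.2 ⟨hfC, hb⟩)
    have hbe : b ≠ e := fun h => heC (h ▸ hb)
    have hfe : N.IsCircuit {f, e} := by rwa [Set.pair_comm]
    obtain ⟨D, hDC, hD, hbD⟩ :=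
      hC.strong_elimination hfe hfC (by simp) hb (by simp [hbe, hbf])
    have hfD : f ∉ D := fun h => (hDC h).2 rfl
    have hdM : M.Dep D := by
      refine (not_indep_iff ?_).1 fun hi => hD.not_indep ((hdel D hfD).1 hi)
      intro x hx
      have : x ∈ N.E \ {f} := ⟨hD.subset_ground hx, fun h => hfD (h ▸ hx)⟩
      exact (hE ▸ this : x ∈ M.E \ {f}).1
    obtain ⟨D₁, hD₁, hD₁c⟩ := hdM.exists_isCircuit_subset
    by_cases heD : e ∈ D₁
    · obtain ⟨x, hx, hxe⟩ : ∃ x ∈ D₁, x ≠ e := by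
        by_contra! hx
        have h1 : D₁ = {e} := Set.eq_singleton_iff_unique_mem.2 ⟨heD, hx⟩
        have h2 := hM.eq_of_superset_isCircuit hD₁c (by simp [h1])
        exact hfD (hD₁ (h2 ▸ (by simp)))
      have hxf : x ≠ f := fun h => hfD (hD₁ (h ▸ hx))
      obtain ⟨D₂, hD₂, hD₂c, -⟩ :=
        hD₁c.strong_elimination hM heD (by simp) hx (by simp [hxe, hxf])
      refine hD₂c.not_indep (hCM.subset fun y hy => ?_)
      obtain ⟨h1 | h1, h2⟩ := hD₂ hy
      · obtain ⟨h3 | h3 | h3, h4⟩ := hDC (hD₁ h1)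
        · exact h3
        · exact absurd h3 h4
        · exact absurd h3 h2
      · rcases h1 with h1 | h1
        · exact absurd h1 h2
        · exact h1 ▸ hfC
    · refine hD₁c.not_indep (hCM.subset fun y hy => ?_)
      obtain ⟨h3 | h3 | h3, h4⟩ := hDC (hD₁ hy)
      · exact h3
      · exact absurd h3 h4
      · exact absurd (h3 ▸ hy) heD
  have hE : M.E = N.E := by
    have h1 : M.E \ {f} = N.E \ {f} := congrArg Matroid.E h
    rw [← Set.insert_eq_of_mem (hM.subset_ground (show f ∈ ({e, f} : Set α) by simp)),
      ← Set.insert_eq_of_mem (hN.subset_ground (show f ∈ ({e, f} : Set α) by simp)),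
      ← Set.insert_sdiff_singleton, h1, Set.insert_sdiff_singleton]
  exact ext_indep hE fun I _ => ⟨aux hM hN h I, aux hN hM h.symm I⟩

theorem eq_of_contract_eq_of_isCocircuit {N : Matroid α} (hM : M.IsCocircuit {e, f})
    (hN : N.IsCocircuit {e, f}) (h : M.contract {f} = N.contract {f}) : M = N := by
  refine dual_injective (eq_of_delete_eq_of_isCircuit hM hN ?_)
  rw [← dual_contract, ← dual_contract, h]

end Matroid

/-! ### Bipartite graphs without dominoes and long holes -/

namespace SimpleGraph

variable {V : Type*}

/-- `G` has an induced domino (a cycle of length six with one long chord), up to the pairs of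
vertices on the same side of a bipartition. -/
def HasDomino (G : SimpleGraph V) : Prop :=
  ∃ a b c x y z, G.Adj a x ∧ G.Adj a y ∧ G.Adj a z ∧ G.Adj b x ∧ G.Adj b y ∧ ¬ G.Adj b z ∧
    ¬ G.Adj c x ∧ G.Adj c y ∧ G.Adj c z

/-- `G` has an induced cycle of even length at least six: a vertex `v` together with an induced path
`p 0, …, p (2 * m)` that meets the neighbourhood of `v` just in its ends. -/
def HasHole (G : SimpleGraph V) : Prop :=
  ∃ (v : V) (m : ℕ) (p : ℕ → V), 2 ≤ m ∧ (∀ i ≤ 2 * m, ∀ j ≤ 2 * m, p i = p j → i = j) ∧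
    (∀ i ≤ 2 * m, ∀ j ≤ 2 * m, G.Adj (p i) (p j) ↔ j = i + 1 ∨ i = j + 1) ∧
    ∀ i ≤ 2 * m, G.Adj v (p i) ↔ i = 0 ∨ i = 2 * m

/-- A shortest walk works: its `i`th vertex is at distance `i` from `x`, so vertices do not repeat
and adjacent ones have consecutive indices. -/
theorem Reachable.exists_induced_path {H : SimpleGraph V} {x y : V} (h : H.Reachable x y) :
    ∃ (n : ℕ) (p : ℕ → V), p 0 = x ∧ p n = y ∧ (∀ i < n, H.Adj (p i) (p (i + 1))) ∧
      (∀ i ≤ n, ∀ j ≤ n, p i = p j → i = j) ∧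
      ∀ i ≤ n, ∀ j ≤ n, H.Adj (p i) (p j) → j = i + 1 ∨ i = j + 1 := by
  obtain ⟨w, hw⟩ := h.exists_walk_length_eq_dist
  have hd : ∀ i ≤ w.length, H.dist x (w.getVert i) = i := by
    intro i hi
    refine le_antisymm ?_ ?_
    · have h1 := dist_le (w.take i)
      rw [Walk.take_length, min_eq_left hi] at h1
      exact h1
    · obtain ⟨w', hw'⟩ := (w.take i).reachable.exists_walk_length_eq_dist
      have h1 := dist_le (w'.append (w.drop i))
      rw [Walk.length_append, Walk.drop_length] at h1
      omega
  refine ⟨w.length, w.getVert, w.getVert_zero, w.getVert_length,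
    fun i hi => w.adj_getVert_succ hi, fun i hi j hj hij => ?_, fun i hi j hj hij => ?_⟩
  · rw [← hd i hi, hij, hd j hj]
  · have hne : i ≠ j := by rintro rfl; exact hij.ne rfl
    have h1 : H.dist x (w.getVert j) ≤ H.dist x (w.getVert i) + 1 := by
      obtain ⟨w', hw'⟩ := (w.take i).reachable.exists_walk_length_eq_dist
      have := dist_le (w'.concat hij)
      rw [Walk.length_concat] at this
      omega
    have h2 : H.dist x (w.getVert i) ≤ H.dist x (w.getVert j) + 1 := by
      obtain ⟨w', hw'⟩ := (w.take j).reachable.exists_walk_length_eq_dist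
      have := dist_le (w'.concat hij.symm)
      rw [Walk.length_concat] at this
      omega
    rw [hd i hi, hd j hj] at h1 h2
    omega

/-- The vertex `x` is at distance `k` from `u`. -/
def Level (G : SimpleGraph V) (u : V) (k : ℕ) (x : V) : Prop := G.Reachable u x ∧ G.dist u x = k

variable {G : SimpleGraph V} {side : V → Prop} {u : V}

theorem Level.unique {k l : ℕ} {x : V} (h : G.Level u k x) (h' : G.Level u l x) : k = l :=
  h.2.symm.trans h'.2

theorem Level.eq_of_zero {x : V} (h : G.Level u 0 x) : x = u :=
  (h.1.dist_eq_zero_iff.1 h.2).symm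

theorem Walk.side_iff_even (hside : ∀ x y, G.Adj x y → (side x ↔ ¬ side y)) {x y : V}
    (w : G.Walk x y) : side y ↔ (side x ↔ Even w.length) := by
  induction w with
  | nil => simp
  | cons h w ih =>
    rw [Walk.length_cons, Nat.even_add_one, ih, hside _ _ h]
    tauto

/-- Distances of adjacent vertices differ by at most one, and bipartiteness forbids edges within a
level. -/
theorem Level.of_adj (hside : ∀ x y, G.Adj x y → (side x ↔ ¬ side y)) {k : ℕ} {x y : V}
    (h : G.Level u k x) (hxy : G.Adj x y) : G.Level u (k + 1) y ∨ ∃ j, j + 1 = k ∧ G.Level u j y := by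
  obtain ⟨w, hw⟩ := h.1.exists_walk_length_eq_dist
  have hy : G.Reachable u y := h.1.trans hxy.reachable
  obtain ⟨w', hw'⟩ := hy.exists_walk_length_eq_dist
  have h1 := dist_le (w.concat hxy)
  have h2 := dist_le (w'.concat hxy.symm)
  rw [Walk.length_concat] at h1 h2
  have hk := h.2
  have h3 : G.dist u y ≠ G.dist u x := by
    intro heq
    have h4 := w.side_iff_even hside
    have h5 := w'.side_iff_even hside
    rw [hw', heq, ← hw] at h5
    have h6 := hside _ _ hxy
    tauto
  rcases Nat.lt_or_gt_of_ne h3 with h4 | h4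
  · exact Or.inr ⟨G.dist u y, by omega, hy, rfl⟩
  · exact Or.inl ⟨hy, by omega⟩

theorem Level.exists_adj {k : ℕ} {x : V} (h : G.Level u (k + 1) x) :
    ∃ y, G.Adj x y ∧ G.Level u k y := by
  obtain ⟨w, hw⟩ := h.1.symm.exists_walk_length_eq_dist
  have hk := h.2
  rw [dist_comm] at hk
  cases w with
  | nil => simp at hk
  | @cons _ y _ hxy w =>
    rw [Walk.length_cons] at hw
    refine ⟨y, hxy, w.reachable.symm, ?_⟩
    obtain ⟨w', hw'⟩ := w.reachable.exists_walk_length_eq_dist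
    have h1 := dist_le w
    have h2 := dist_le (Walk.cons hxy w')
    rw [Walk.length_cons] at h2
    rw [dist_comm]
    omega

/-- Join `x` to `y` by a shortest path whose interior lies strictly below level `k`, and close it
through `v`. The interior is too low to be adjacent to `v`; the length is even by bipartiteness,
nonzero as `x ≠ y`, and not two because `x` and `y` have no common neighbour below. -/
theorem HasHole.of_level (hside : ∀ x y, G.Adj x y → (side x ↔ ¬ side y)) {k : ℕ} {x y v : V}
    (hx : G.Level u k x) (hy : G.Level u k y) (hxy : x ≠ y) (hv : G.Level u (k + 1) v)
    (hvx : G.Adj v x) (hvy : G.Adj v y)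
    (hcom : ∀ w j, j + 1 = k → G.Level u j w → G.Adj w x → ¬ G.Adj w y) : G.HasHole := by
  let S : V → Prop := fun z => z = x ∨ z = y ∨ ∃ j < k, G.Level u j z
  let H : SimpleGraph V :=
    { Adj := fun a b => G.Adj a b ∧ S a ∧ S b
      symm := ⟨fun a b h => ⟨h.1.symm, h.2.2, h.2.1⟩⟩
      loopless := ⟨fun a h => h.1.ne rfl⟩ }
  have hreach : ∀ j ≤ k, ∀ z, S z → G.Level u j z → H.Reachable z u := by
    intro j
    induction j with
    | zero => intro _ z _ hz; rw [hz.eq_of_zero]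
    | succ j ih =>
      intro hj z hzS hz
      obtain ⟨z', hzz', hz'⟩ := hz.exists_adj
      have hS' : S z' := Or.inr (Or.inr ⟨j, by omega, hz'⟩)
      have hadj : H.Adj z z' := ⟨hzz', hzS, hS'⟩
      exact hadj.reachable.trans (ih (by omega) z' hS' hz')
  have hxS : S x := Or.inl rfl
  have hyS : S y := Or.inr (Or.inl rfl)
  obtain ⟨n, p, h0, hn, hadj, hinj, hind⟩ :=
    ((hreach k le_rfl x hxS hx).trans (hreach k le_rfl y hyS hy).symm).exists_induced_path
  have hn0 : n ≠ 0 := by rintro rfl; exact hxy (h0.symm.trans hn)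
  have hS : ∀ i ≤ n, S (p i) := by
    intro i hi
    rcases hi.lt_or_eq with hi | rfl
    · exact (hadj i hi).2.1
    · rwa [hn]
  have hpar : ∀ i ≤ n, (side (p i) ↔ (side x ↔ Even i)) := by
    intro i
    induction i with
    | zero => simp [h0]
    | succ i ih =>
      intro hi
      have h1 := ih (by omega)
      have h2 := hside _ _ (hadj i hi).1
      rw [Nat.even_add_one]
      tauto
  have heven : Even n := by
    have h1 := hpar n le_rfl
    have h2 := hside _ _ hvx
    have h3 := hside _ _ hvy
    rw [hn] at h1
    tauto
  have hmid : ∀ i ≤ n, i ≠ 0 → i ≠ n → ∃ j < k, G.Level u j (p i) := by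
    intro i hi hi0 hin
    rcases hS i hi with h1 | h1 | h1
    · exact absurd (hinj i hi 0 (by omega) (h1.trans h0.symm)) hi0
    · exact absurd (hinj i hi n le_rfl (h1.trans hn.symm)) hin
    · exact h1
  have hn2 : n ≠ 2 := by
    rintro rfl
    obtain ⟨j, hj, h1⟩ := hmid 1 (by omega) (by omega) (by omega)
    have hx1 : G.Adj (p 1) x := h0 ▸ (hadj 0 (by omega)).1.symm
    have hy1 : G.Adj (p 1) y := hn ▸ (hadj 1 (by omega)).1
    refine hcom (p 1) j ?_ h1 hx1 hy1
    rcases h1.of_adj hside hx1 with h2 | ⟨i, hi, h2⟩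
    · exact h2.unique hx
    · have := h2.unique hx
      omega
  obtain ⟨m, hm⟩ := heven
  have hm' : 2 * m = n := by omega
  refine ⟨v, m, p, by omega, ?_, ?_, ?_⟩
  · rw [hm']; exact hinj
  · rw [hm']
    refine fun i hi j hj => ⟨fun h => hind i hi j hj ⟨h, hS i hi, hS j hj⟩, ?_⟩
    rintro (rfl | rfl)
    · exact (hadj i (by omega)).1
    · exact (hadj j (by omega)).1.symm
  · rw [hm']
    refine fun i hi => ⟨fun h => ?_, ?_⟩
    · by_contra! hcon
      obtain ⟨j, hj, h1⟩ := hmid i hi hcon.1 hcon.2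
      rcases h1.of_adj hside h.symm with h2 | ⟨i, hi, h2⟩
      · have := h2.unique hv
        omega
      · have := h2.unique hv
        omega
    · rintro (rfl | rfl)
      · rwa [h0]
      · rwa [hn]

/-- Vertices of one level with a common neighbour above have the same neighbours below. If `s` is
adjacent to `x` alone, the absence of holes gives a common lower neighbour `w` of `x` and `y`. By
induction `w` and `s`, joined above by `x`, share a neighbour `p` below, and these vertices form a
domino. -/
theorem Level.adj_of_common_adj (hside : ∀ x y, G.Adj x y → (side x ↔ ¬ side y))
    (hdom : ¬ G.HasDomino) (hhole : ¬ G.HasHole) {k : ℕ} : ∀ {x y v s : V}, G.Level u (k + 1) x →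
    G.Level u (k + 1) y → G.Level u (k + 2) v → G.Adj v x → G.Adj v y → G.Level u k s →
    G.Adj s x → G.Adj s y := by
  induction k with
  | zero =>
    intro x y v s _ hy _ _ _ hs _
    obtain ⟨z, hyz, hz⟩ := hy.exists_adj
    rw [hs.eq_of_zero, ← hz.eq_of_zero]
    exact hyz.symm
  | succ k ih =>
    intro x y v s hx hy hv hvx hvy hs hsx
    by_contra hsy
    have hxy : x ≠ y := by rintro rfl; exact hsy hsx
    refine hhole (HasHole.of_level hside hx hy hxy hv hvx hvy ?_)
    intro w j hj hw hwx hwy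
    obtain rfl : j = k + 1 := by omega
    obtain ⟨p, hwp, hp⟩ := hw.exists_adj
    have hps := ih hw hs hx hwx.symm hsx.symm hp hwp.symm
    refine hdom ⟨w, v, s, y, x, p, hwy, hwx, hwp, hvy, hvx, fun hvp => ?_, hsy, hsx, hps.symm⟩
    rcases hp.of_adj hside hvp.symm with h2 | ⟨i, hi, h2⟩
    · have := h2.unique hv
      omega
    · have := h2.unique hv
      omega

/-- A finite bipartite graph with an edge and without dominoes and long holes has a vertex of
degree one or two twins. -/
theorem exists_pendant_or_twins [Finite V] (hside : ∀ x y, G.Adj x y → (side x ↔ ¬ side y))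
    (hdom : ¬ G.HasDomino) (hhole : ¬ G.HasHole) {w : V} (huw : G.Adj u w) :
    ∃ e f, e ≠ f ∧ ((∀ g, G.Adj e g ↔ g = f) ∨
      (∃ g, G.Adj e g) ∧ ∀ g, G.Adj e g ↔ G.Adj f g) := by
  obtain ⟨v₀, hv₀, hmax⟩ := Set.exists_max_image {x | G.Reachable u x} (G.dist u)
    (Set.toFinite _) ⟨u, Reachable.refl u⟩
  obtain ⟨k, hk⟩ : ∃ k, G.dist u v₀ = k + 1 := by
    have h1 := hmax w huw.reachable
    have h2 : G.dist u w = 1 := dist_eq_one_iff_adj.2 huw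
    exact ⟨G.dist u v₀ - 1, by omega⟩
  -- `v` has least degree in the last nonempty level, so all neighbours of vertices in that level
  -- lie one level lower. Either `v` is pendant or any two of its neighbours turn out to be twins.
  obtain ⟨v, hv, hmin⟩ := Set.exists_min_image {x | G.Level u (k + 1) x}
    (fun x => (G.neighborSet x).ncard) (Set.toFinite _) ⟨v₀, hv₀, hk⟩
  have hlow : ∀ {z x}, G.Level u (k + 1) z → G.Adj z x → G.Level u k x := by
    intro z x hz hzx
    rcases Level.of_adj hside hz hzx with h1 | ⟨j, hj, h1⟩
    · have h2 := hmax x h1.1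
      have h3 := h1.2
      omega
    · rwa [← Nat.succ_injective hj]
  obtain ⟨x, hvx, hx⟩ := Level.exists_adj hv
  by_cases hpend : ∀ g, G.Adj v g → g = x
  · exact ⟨v, x, hvx.ne, Or.inl fun g => ⟨hpend g, fun h => h ▸ hvx⟩⟩
  push Not at hpend
  obtain ⟨y, hvy, hyx⟩ := hpend
  have key : ∀ {x y}, G.Adj v x → G.Adj v y → x ≠ y → ∀ g, G.Adj x g → G.Adj y g := by
    intro x y hvx hvy hxy g hxg
    have hx := hlow hv hvx
    have hy := hlow hv hvy
    obtain ⟨j, rfl⟩ : ∃ j, k = j + 1 := by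
      cases k with
      | zero => exact absurd (hx.eq_of_zero.trans hy.eq_of_zero.symm) hxy
      | succ j => exact ⟨j, rfl⟩
    rcases Level.of_adj hside hx hxg with hg | ⟨i, hi, hg⟩
    swap
    · obtain rfl : i = j := by omega
      exact (Level.adj_of_common_adj hside hdom hhole hx hy hv hvx hvy hg hxg.symm).symm
    by_contra hyg
    -- By the choice of `v`, inclusion would force equality of neighbourhoods, but `y` is adjacent
    -- to `v` and not to `g`. So `g` has a private neighbour `z`, and a common parent `t` of `x`,
    -- `y` and `z` completes a domino.
    have hnss : ¬ G.neighborSet g ⊆ G.neighborSet v := by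
      intro hss
      have h1 := Set.eq_of_subset_of_ncard_le hss (hmin g hg) (Set.toFinite _)
      have h2 : y ∈ G.neighborSet g := h1 ▸ hvy
      exact hyg h2.symm
    obtain ⟨z, hgz, hvz⟩ := Set.not_subset.1 hnss
    have hz := hlow hg hgz
    obtain ⟨t, hxt, ht⟩ := hx.exists_adj
    have hty := Level.adj_of_common_adj hside hdom hhole hx hy hv hvx hvy ht hxt.symm
    have htz := Level.adj_of_common_adj hside hdom hhole hx hz hg hxg.symm hgz ht hxt.symm
    exact hdom ⟨t, v, g, y, x, z, hty, hxt.symm, htz, hvy, hvx, hvz, fun h => hyg h.symm,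
      hxg.symm, hgz⟩
  exact ⟨x, y, hyx.symm, Or.inr ⟨⟨v, hvx.symm⟩,
    fun g => ⟨key hvx hvy hyx.symm g, key hvy hvx hyx g⟩⟩⟩

end SimpleGraph

/-! ### Projections onto the Fano plane -/

/-- There is a projection of `S` onto `GF(2)³` that covers all nonzero vectors with at most one
exception `t`, and whose kernel is spanned by elements of `S` (so that it is a contraction). -/
def HasK4Projection {W : Type*} [AddCommGroup W] [Module (ZMod 2) W] (S : Set W) : Prop :=
  ∃ φ : W →ₗ[ZMod 2] (Fin 3 → ZMod 2),
    (∀ w ∈ Submodule.span (ZMod 2) S, φ w = 0 →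
      w ∈ Submodule.span (ZMod 2) (S ∩ {s | φ s = 0})) ∧
    ∃ t, ∀ z, z ≠ 0 → z ≠ t → ∃ s ∈ S, φ s = z

theorem ZMod.two_eq_zero_or_one : ∀ c : ZMod 2, c = 0 ∨ c = 1 := by decide

theorem add_self_eq_zero_of_zmod_two {W : Type*} [AddCommGroup W] [Module (ZMod 2) W] (w : W) :
    w + w = 0 := by
  rw [← one_smul (ZMod 2) w, ← add_smul, show (1 + 1 : ZMod 2) = 0 from rfl, zero_smul]

/-- A basis `B` of the span of a finite family `v` of vectors, consisting of members of the family,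
together with the coordinate functionals `l`. -/
structure CoordinateSystem {W ι : Type*} [AddCommGroup W] [Module (ZMod 2) W] (v : ι → W) where
  /-- the index set of the basis -/
  B : Finset ι
  /-- the coordinate functionals -/
  l : ι → W →ₗ[ZMod 2] ZMod 2
  l_self : ∀ x ∈ B, l x (v x) = 1
  l_of_ne : ∀ x ∈ B, ∀ y ∈ B, x ≠ y → l x (v y) = 0
  sum_eq : ∀ w ∈ Submodule.span (ZMod 2) (Set.range v), ∑ x ∈ B, l x w • v x = w

theorem exists_coordinateSystem {W ι : Type*} [AddCommGroup W] [Module (ZMod 2) W] [Finite ι]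
    {v : ι → W} {I : Set ι} (hI : LinearIndepOn (ZMod 2) v I) :
    ∃ c : CoordinateSystem v, I ⊆ c.B := by
  classical
  obtain ⟨B, hB, hIB⟩ := Matroid.Indep.exists_isBase_superset
    (Matroid.ofVectors_indep_iff.2 ⟨Set.subset_univ I, hI⟩)
  have hspan := Matroid.ofVectors_span_of_isBasis hB.isBasis_ground
  rw [Matroid.ofVectors_ground, Set.image_univ] at hspan
  have hind := linearIndepOn_iff_notMem_span.1 hB.indep.2
  have hl : ∀ x, ∃ l : W →ₗ[ZMod 2] ZMod 2, x ∈ B → l (v x) = 1 ∧ ∀ y ∈ B, x ≠ y → l (v y) = 0 := by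
    intro x
    by_cases hx : x ∈ B
    · obtain ⟨l, h1, h2⟩ := Submodule.exists_le_ker_of_notMem (hind x hx)
      refine ⟨l, fun _ => ⟨(ZMod.two_eq_zero_or_one _).resolve_left h1, fun y hy hxy => ?_⟩⟩
      exact h2 (Submodule.subset_span ⟨y, ⟨hy, fun h => hxy h.symm⟩, rfl⟩)
    · exact ⟨0, fun h => absurd h hx⟩
  choose l hl using hl
  have hfin : B.Finite := Set.toFinite _
  refine ⟨⟨hfin.toFinset, l, fun x hx => (hl x (by simpa using hx)).1,
    fun x hx y hy => (hl x (by simpa using hx)).2 y (by simpa using hy), fun w hw => ?_⟩, by simpa using hIB⟩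
  rw [← hspan] at hw
  induction hw using Submodule.span_induction with
  | mem w hw =>
    obtain ⟨y, hy, rfl⟩ := hw
    rw [Finset.sum_eq_single y]
    · rw [(hl y hy).1, one_smul]
    · intro x hx hxy
      rw [(hl x (by simpa using hx)).2 y hy hxy, zero_smul]
    · intro h
      exact absurd hy (by simpa using h)
  | zero => simp
  | add a b _ _ ha hb => simp only [map_add, add_smul, Finset.sum_add_distrib, ha, hb]
  | smul c a _ ha => simp only [map_smul, smul_assoc, ← Finset.smul_sum, ha]

/-! ### Dominoes and holes of the fundamental graph as projections -/

namespace CoordinateSystem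

variable {W ι : Type*} [AddCommGroup W] [Module (ZMod 2) W] {v : ι → W} (c : CoordinateSystem v)

/-- The fundamental graph: a basis element is adjacent to the elements outside the basis in which
it has coordinate one. -/
def graph : SimpleGraph ι where
  Adj e f := e ∈ c.B ∧ f ∉ c.B ∧ c.l e (v f) = 1 ∨ f ∈ c.B ∧ e ∉ c.B ∧ c.l f (v e) = 1
  symm := ⟨fun _ _ h => h.symm⟩
  loopless := ⟨fun _ h => by rcases h with h | h <;> exact h.2.1 h.1⟩

theorem graph_adj_iff {e f : ι} (he : e ∈ c.B) : c.graph.Adj e f ↔ f ∉ c.B ∧ c.l e (v f) = 1 := by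
  simp [graph, he]

theorem graph_side {e f : ι} (h : c.graph.Adj e f) : e ∈ c.B ↔ ¬ f ∈ c.B := by
  rcases h with h | h <;> simp [h.1, h.2.1]

theorem l_eq_ite {e f : ι} (he : e ∈ c.B) (hf : f ∉ c.B) [Decidable (c.graph.Adj e f)] :
    c.l e (v f) = if c.graph.Adj e f then 1 else 0 := by
  split_ifs with h
  · exact ((c.graph_adj_iff he).1 h).2
  · exact (ZMod.two_eq_zero_or_one _).resolve_right fun h1 => h ((c.graph_adj_iff he).2 ⟨hf, h1⟩)

theorem l_basis [DecidableEq ι] {x y : ι} (hx : x ∈ c.B) (hy : y ∈ c.B) :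
    c.l x (v y) = if x = y then 1 else 0 := by
  split_ifs with h
  · rw [← h, c.l_self x hx]
  · exact c.l_of_ne x hx y hy h

/-- The projection onto the coordinates `a` and `b` and the sum of the coordinates in `J`. -/
noncomputable def proj (a b : ι) (J : Finset ι) : W →ₗ[ZMod 2] (Fin 3 → ZMod 2) :=
  LinearMap.pi ![c.l a, c.l b, ∑ j ∈ J, c.l j]

theorem proj_apply (a b : ι) (J : Finset ι) (w : W) :
    c.proj a b J w = ![c.l a w, c.l b w, ∑ j ∈ J, c.l j w] := by
  ext i
  fin_cases i <;> simp [proj]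

/-- Expand `w` in the basis. Terms at `a` and `b` vanish, and basis elements outside `J` other than
these are killed by the projection. The coordinates in `J` add up to zero, so each `v j` may be
replaced by `v j + v j₀` without changing the sum. -/
theorem proj_ker {a b : ι} {J : Finset ι} (ha : a ∈ c.B) (hb : b ∈ c.B) (hJ : J ⊆ c.B)
    {j₀ : ι}
    (hsum : ∀ j ∈ J, v j + v j₀ ∈
      Submodule.span (ZMod 2) (Set.range v ∩ {s | c.proj a b J s = 0}))
    {w : W} (hw : w ∈ Submodule.span (ZMod 2) (Set.range v)) (h0 : c.proj a b J w = 0) :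
    w ∈ Submodule.span (ZMod 2) (Set.range v ∩ {s | c.proj a b J s = 0}) := by
  classical
  rw [proj_apply] at h0
  have h1 : c.l a w = 0 := congrFun h0 0
  have h2 : c.l b w = 0 := congrFun h0 1
  have h3 : ∑ j ∈ J, c.l j w = 0 := congrFun h0 2
  rw [← c.sum_eq w hw, ← Finset.sum_sdiff hJ]
  refine Submodule.add_mem _ (Submodule.sum_mem _ fun x hx => ?_) ?_
  · rw [Finset.mem_sdiff] at hx
    by_cases hxa : x = a
    · rw [hxa, h1, zero_smul]; exact Submodule.zero_mem _
    by_cases hxb : x = b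
    · rw [hxb, h2, zero_smul]; exact Submodule.zero_mem _
    refine Submodule.smul_mem _ _ (Submodule.subset_span ⟨⟨x, rfl⟩, ?_⟩)
    have h4 : ∑ j ∈ J, c.l j (v x) = 0 :=
      Finset.sum_eq_zero fun j hj => c.l_of_ne j (hJ hj) x hx.1 (by rintro rfl; exact hx.2 hj)
    simp only [Set.mem_ofPred_eq, proj_apply, h4, c.l_of_ne a ha x hx.1 (Ne.symm hxa),
      c.l_of_ne b hb x hx.1 (Ne.symm hxb)]
    ext i
    fin_cases i <;> rfl
  · have h5 : ∑ x ∈ J, c.l x w • v x = ∑ x ∈ J, c.l x w • (v x + v j₀) := by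
      simp only [smul_add, Finset.sum_add_distrib, ← Finset.sum_smul, h3, zero_smul, add_zero]
    rw [h5]
    exact Submodule.sum_mem _ fun x hx => Submodule.smul_mem _ _ (hsum x hx)

theorem hasK4Projection_of_domino_aux {a b e x y z : ι} (ha : a ∈ c.B) (hb : b ∈ c.B)
    (he : e ∈ c.B) (hab : a ≠ b) (hae : a ≠ e) (hbe : b ≠ e) (hx : c.proj a b {e} (v x) = ![1, 1, 0])
    (hy : c.proj a b {e} (v y) = ![1, 1, 1]) (hz : c.proj a b {e} (v z) = ![1, 0, 1]) :
    HasK4Projection (Set.range v) := by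
  refine ⟨c.proj a b {e}, fun w hw h0 => c.proj_ker ha hb (by simpa using he)
    (j₀ := e) ?_ hw h0, ![0, 1, 1], ?_⟩
  · intro j hj
    rw [Finset.mem_singleton.1 hj, add_self_eq_zero_of_zmod_two]
    exact Submodule.zero_mem _
  · have ha' : c.proj a b {e} (v a) = ![1, 0, 0] := by
      rw [proj_apply, Finset.sum_singleton, c.l_self a ha, c.l_of_ne b hb a ha hab.symm,
        c.l_of_ne e he a ha hae.symm]
    have hb' : c.proj a b {e} (v b) = ![0, 1, 0] := by
      rw [proj_apply, Finset.sum_singleton, c.l_self b hb, c.l_of_ne a ha b hb hab,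
        c.l_of_ne e he b hb hbe.symm]
    have he' : c.proj a b {e} (v e) = ![0, 0, 1] := by
      rw [proj_apply, Finset.sum_singleton, c.l_self e he, c.l_of_ne a ha e he hae,
        c.l_of_ne b hb e he hbe]
    have hcases : ∀ z : Fin 3 → ZMod 2, z ≠ 0 → z ≠ ![0, 1, 1] → z = ![1, 0, 0] ∨ z = ![0, 1, 0] ∨
        z = ![0, 0, 1] ∨ z = ![1, 1, 0] ∨ z = ![1, 1, 1] ∨ z = ![1, 0, 1] := by decide
    intro z hz0 hzt
    rcases hcases z hz0 hzt with rfl | rfl | rfl | rfl | rfl | rfl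
    · exact ⟨_, ⟨a, rfl⟩, ha'⟩
    · exact ⟨_, ⟨b, rfl⟩, hb'⟩
    · exact ⟨_, ⟨e, rfl⟩, he'⟩
    · exact ⟨_, ⟨x, rfl⟩, hx⟩
    · exact ⟨_, ⟨y, rfl⟩, hy⟩
    · exact ⟨_, ⟨z, rfl⟩, hz⟩

/-- The domino is symmetric under exchanging the sides of its bipartition, so the same three
coordinate columns arise whichever side lies in the basis. -/
theorem hasK4Projection_of_domino (h : c.graph.HasDomino) : HasK4Projection (Set.range v) := by
  classical
  obtain ⟨a, b, e, x, y, z, hax, hay, haz, hbx, hby, hbz, hex, hey, hez⟩ := h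
  have hab : a ≠ b := by rintro rfl; exact hbz haz
  have hae : a ≠ e := by rintro rfl; exact hex hax
  have hbe : b ≠ e := by rintro rfl; exact hex hbx
  have hxy : x ≠ y := by rintro rfl; exact hex hey
  have hxz : x ≠ z := by rintro rfl; exact hbz hbx
  have hyz : y ≠ z := by rintro rfl; exact hbz hby
  by_cases ha : a ∈ c.B
  · have hx := (c.graph_side hax).1 ha
    have hy := (c.graph_side hay).1 ha
    have hz := (c.graph_side haz).1 ha
    have hb := (c.graph_side hbx).2 hx
    have he := (c.graph_side hey).2 hy
    refine c.hasK4Projection_of_domino_aux ha hb he hab hae hbe (x := x) (y := y) (z := z)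
      ?_ ?_ ?_ <;>
    · rw [proj_apply, Finset.sum_singleton, c.l_eq_ite ha (by assumption),
        c.l_eq_ite hb (by assumption), c.l_eq_ite he (by assumption)]
      simp [*]
  · have hx := not_not.1 (mt (c.graph_side hax).2 ha)
    have hy := not_not.1 (mt (c.graph_side hay).2 ha)
    have hz := not_not.1 (mt (c.graph_side haz).2 ha)
    have hb : b ∉ c.B := fun h => (c.graph_side hbx).1 h hx
    have he : e ∉ c.B := fun h => (c.graph_side hey).1 h hy
    rw [SimpleGraph.adj_comm] at hax hay haz hbx hby hbz hex hey hez
    refine c.hasK4Projection_of_domino_aux hy hx hz hxy.symm hyz hxz (x := b) (y := a) (z := e)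
      ?_ ?_ ?_ <;>
    · rw [proj_apply, Finset.sum_singleton, c.l_eq_ite hx (by assumption),
        c.l_eq_ite hy (by assumption), c.l_eq_ite hz (by assumption)]
      simp [*]

/-- Contracting `y 2, …, y (m - 1)` identifies `b 2, …, b m` and shrinks the cycle to a hexagon;
basis elements off the cycle are contracted too. Algebraically, the third coordinate sums over `b 2,
…, b m`. The hexagon supplies the unit vectors and their pairwise sums, so only `![1, 1, 1]` may be
missed. -/
theorem hasK4Projection_of_cycle {m : ℕ} (hm : 2 ≤ m) {b y : ℕ → ι} (hb : ∀ i ≤ m, b i ∈ c.B)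
    (hy : ∀ i ≤ m, y i ∉ c.B) (hinj : ∀ i ≤ m, ∀ j ≤ m, b i = b j → i = j)
    (hadj : ∀ i < m, ∀ j ≤ m, c.graph.Adj (b j) (y i) ↔ j = i ∨ j = i + 1)
    (hlast : ∀ j ≤ m, c.graph.Adj (b j) (y m) ↔ j = 0 ∨ j = m) :
    HasK4Projection (Set.range v) := by
  classical
  set J : Finset ι := (Finset.Icc 2 m).image b with hJ
  have hJB : J ⊆ c.B := by
    rw [hJ, Finset.image_subset_iff]
    exact fun i hi => hb i (Finset.mem_Icc.1 hi).2
  have hsumJ : ∀ w, ∑ j ∈ J, c.l j w = ∑ i ∈ Finset.Icc 2 m, c.l (b i) w := fun w =>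
    Finset.sum_image fun i hi j hj h =>
      hinj i (Finset.mem_Icc.1 hi).2 j (Finset.mem_Icc.1 hj).2 h
  have hval : ∀ i < m, ∀ j ≤ m, c.l (b j) (v (y i)) = if j = i ∨ j = i + 1 then 1 else 0 := by
    intro i hi j hj
    rw [c.l_eq_ite (hb j hj) (hy i hi.le)]
    simp only [hadj i hi j hj]
  have hvlast : ∀ j ≤ m, c.l (b j) (v (y m)) = if j = 0 ∨ j = m then 1 else 0 := by
    intro j hj
    rw [c.l_eq_ite (hb j hj) (hy m le_rfl)]
    simp only [hlast j hj]
  have hvb : ∀ i ≤ m, ∀ j ≤ m, c.l (b j) (v (b i)) = if j = i then 1 else 0 := by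
    intro i hi j hj
    rw [c.l_basis (hb j hj) (hb i hi)]
    have : b j = b i ↔ j = i := ⟨hinj j hj i hi, fun h => h ▸ rfl⟩
    simp only [this]
  have h0m : 0 ≤ m := by omega
  have h1m : 1 ≤ m := by omega
  have pb : ∀ i ≤ m, c.proj (b 0) (b 1) J (v (b i)) =
      ![if 0 = i then 1 else 0, if 1 = i then 1 else 0, if 2 ≤ i then 1 else 0] := by
    intro i hi
    rw [proj_apply, hsumJ, hvb i hi 0 h0m, hvb i hi 1 h1m,
      Finset.sum_congr rfl fun j hj => hvb i hi j (Finset.mem_Icc.1 hj).2]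
    simp [Finset.sum_ite_eq', hi]
  have hsum2 : ∀ i, 2 ≤ i → i < m →
      ∑ j ∈ Finset.Icc 2 m, c.l (b j) (v (y i)) = 0 := by
    intro i hi him
    rw [Finset.sum_congr rfl fun j hj => hval i him j (Finset.mem_Icc.1 hj).2,
      ← Finset.sum_filter, Finset.sum_const]
    have : (Finset.Icc 2 m).filter (fun j => j = i ∨ j = i + 1) = {i, i + 1} := by
      ext j
      simp only [Finset.mem_filter, Finset.mem_Icc, Finset.mem_insert, Finset.mem_singleton]
      omega
    rw [this, Finset.card_pair (by omega)]
    rfl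
  have py : ∀ i, 2 ≤ i → i < m → c.proj (b 0) (b 1) J (v (y i)) = 0 := by
    intro i hi him
    rw [proj_apply, hsumJ, hsum2 i hi him, hval i him 0 h0m, hval i him 1 h1m,
      if_neg (by omega), if_neg (by omega)]
    ext k
    fin_cases k <;> rfl
  set U := Submodule.span (ZMod 2) (Set.range v ∩ {s | c.proj (b 0) (b 1) J s = 0}) with hU
  -- `y i` lies in the kernel and equals `b i + b (i + 1)` plus basis elements off the cycle, which
  -- also lie in the kernel.
  have hstep : ∀ i, 2 ≤ i → i < m → v (b i) + v (b (i + 1)) ∈ U := by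
    intro i hi him
    have hne : b i ≠ b (i + 1) := fun h => by
      have := hinj i him.le (i + 1) him h
      omega
    have hsub : {b i, b (i + 1)} ⊆ c.B := by
      intro x hx
      rcases Finset.mem_insert.1 hx with rfl | hx
      · exact hb i him.le
      · rw [Finset.mem_singleton.1 hx]; exact hb _ him
    have h1 := c.sum_eq (v (y i)) (Submodule.subset_span ⟨_, rfl⟩)
    rw [← Finset.sum_sdiff hsub, Finset.sum_pair hne, hval i him i him.le, hval i him (i + 1) him,
      if_pos (Or.inl rfl), if_pos (Or.inr rfl), one_smul, one_smul, add_comm] at h1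
    rw [eq_sub_of_add_eq h1]
    refine Submodule.sub_mem _ (Submodule.subset_span ⟨⟨_, rfl⟩, py i hi him⟩)
      (Submodule.sum_mem _ fun x hx => ?_)
    rw [Finset.mem_sdiff, Finset.mem_insert, Finset.mem_singleton] at hx
    by_cases hxb : ∃ j ≤ m, b j = x
    · obtain ⟨j, hj, rfl⟩ := hxb
      rw [hval i him j hj, if_neg, zero_smul]
      · exact Submodule.zero_mem _
      · rintro (rfl | rfl) <;> exact hx.2 (by simp)
    · push Not at hxb
      refine Submodule.smul_mem _ _ (Submodule.subset_span ⟨⟨_, rfl⟩, ?_⟩)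
      have hz : ∀ j ≤ m, c.l (b j) (v x) = 0 := fun j hj =>
        c.l_of_ne _ (hb j hj) x hx.1 (hxb j hj)
      simp only [Set.mem_ofPred_eq, proj_apply, hsumJ, hz 0 h0m, hz 1 h1m,
        Finset.sum_eq_zero fun j hj => hz j (Finset.mem_Icc.1 hj).2]
      ext k
      fin_cases k <;> rfl
  have hchain : ∀ i, i + 2 ≤ m → v (b (i + 2)) + v (b 2) ∈ U := by
    intro i
    induction i with
    | zero =>
      intro _
      rw [zero_add, add_self_eq_zero_of_zmod_two]
      exact Submodule.zero_mem _
    | succ i ih =>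
      intro hi
      have h1 := Submodule.add_mem _ (hstep (i + 2) (by omega) (by omega)) (ih (by omega))
      have h2 : v (b (i + 2)) + v (b (i + 2 + 1)) + (v (b (i + 2)) + v (b 2)) =
          v (b (i + 1 + 2)) + v (b 2) + (v (b (i + 2)) + v (b (i + 2))) := by
        rw [show i + 1 + 2 = i + 2 + 1 by omega]
        abel
      rwa [h2, add_self_eq_zero_of_zmod_two, add_zero] at h1
  refine ⟨c.proj (b 0) (b 1) J, fun w hw h0 => c.proj_ker (hb 0 h0m) (hb 1 h1m) hJB
    (j₀ := b 2) ?_ hw h0, ![1, 1, 1], ?_⟩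
  · intro j hj
    obtain ⟨i, hi, rfl⟩ := Finset.mem_image.1 hj
    rw [Finset.mem_Icc] at hi
    have := hchain (i - 2) (by omega)
    rwa [show i - 2 + 2 = i by omega] at this
  have hy0 : c.proj (b 0) (b 1) J (v (y 0)) = ![1, 1, 0] := by
    rw [proj_apply, hsumJ, hval 0 (by omega) 0 h0m, hval 0 (by omega) 1 h1m,
      Finset.sum_eq_zero fun j hj => ?_]
    · simp
    · rw [Finset.mem_Icc] at hj
      rw [hval 0 (by omega) j hj.2, if_neg (by omega)]
  have hy1 : c.proj (b 0) (b 1) J (v (y 1)) = ![0, 1, 1] := by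
    rw [proj_apply, hsumJ, hval 1 (by omega) 0 h0m, hval 1 (by omega) 1 h1m,
      Finset.sum_eq_single 2]
    · rw [hval 1 (by omega) 2 hm]
      simp
    · intro j hj hj2
      rw [Finset.mem_Icc] at hj
      rw [hval 1 (by omega) j hj.2, if_neg (by omega)]
    · intro h
      exact absurd (Finset.mem_Icc.2 ⟨le_rfl, hm⟩) h
  have hym : c.proj (b 0) (b 1) J (v (y m)) = ![1, 0, 1] := by
    rw [proj_apply, hsumJ, hvlast 0 h0m, hvlast 1 h1m, Finset.sum_eq_single m]
    · rw [hvlast m le_rfl, if_pos (Or.inl rfl), if_neg (by omega), if_pos (Or.inr rfl)]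
    · intro j hj hjm
      rw [Finset.mem_Icc] at hj
      rw [hvlast j hj.2, if_neg (by omega)]
    · intro h
      exact absurd (Finset.mem_Icc.2 ⟨hm, le_rfl⟩) h
  have hcases : ∀ z : Fin 3 → ZMod 2, z ≠ 0 → z ≠ ![1, 1, 1] → z = ![1, 0, 0] ∨ z = ![0, 1, 0] ∨
      z = ![0, 0, 1] ∨ z = ![1, 1, 0] ∨ z = ![0, 1, 1] ∨ z = ![1, 0, 1] := by decide
  intro z hz0 hzt
  rcases hcases z hz0 hzt with rfl | rfl | rfl | rfl | rfl | rfl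
  · exact ⟨_, ⟨b 0, rfl⟩, by simp [pb 0 h0m]⟩
  · exact ⟨_, ⟨b 1, rfl⟩, by simp [pb 1 h1m]⟩
  · exact ⟨_, ⟨b 2, rfl⟩, by simp [pb 2 hm]⟩
  · exact ⟨_, ⟨y 0, rfl⟩, hy0⟩
  · exact ⟨_, ⟨y 1, rfl⟩, hy1⟩
  · exact ⟨_, ⟨y m, rfl⟩, hym⟩

theorem hasK4Projection_of_hole (h : c.graph.HasHole) : HasK4Projection (Set.range v) := by
  obtain ⟨w, m, p, hm, hinj, hadj, hw⟩ := h
  have hstep : ∀ i < 2 * m, (p i ∈ c.B ↔ ¬ p (i + 1) ∈ c.B) := fun i hi =>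
    c.graph_side ((hadj i hi.le (i + 1) hi).2 (Or.inl rfl))
  have h0 : w ∈ c.B ↔ ¬ p 0 ∈ c.B := c.graph_side ((hw 0 (by omega)).2 (Or.inl rfl))
  have hpar : ∀ i, (2 * i ≤ 2 * m → (p (2 * i) ∈ c.B ↔ w ∉ c.B)) ∧
      (2 * i + 1 ≤ 2 * m → (p (2 * i + 1) ∈ c.B ↔ w ∈ c.B)) := by
    intro i
    induction i with
    | zero =>
      have := hstep 0 (by omega)
      refine ⟨fun _ => ?_, fun _ => ?_⟩
      · simp only [mul_zero]; tauto
      · simp only [mul_zero]; tauto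
    | succ i ih =>
      have h2 : 2 * (i + 1) ≤ 2 * m → (p (2 * (i + 1)) ∈ c.B ↔ w ∉ c.B) := by
        intro hi
        have h3 := hstep (2 * i + 1) (by omega)
        have h4 := ih.2 (by omega)
        rw [show 2 * (i + 1) = 2 * i + 1 + 1 by omega]
        tauto
      refine ⟨h2, fun hi => ?_⟩
      have h3 := hstep (2 * (i + 1)) (by omega)
      have h4 := h2 (by omega)
      tauto
  by_cases hwB : w ∈ c.B
  · have hwp : ∀ i ≤ m, p (2 * i) ∉ c.B := fun i hi => by
      have := (hpar i).1 (by omega)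
      tauto
    have hwp' : ∀ i < m, p (2 * i + 1) ∈ c.B := fun i hi => ((hpar i).2 (by omega)).2 hwB
    -- The hole alternates between the sides, so its basis vertices in cyclic order are `w, p 1, p
    -- 3, …, p (2 * m - 1)`. If `w` is not in the basis they are `p 0, p 2, …, p (2 * m)`, and `w`
    -- becomes the last non-basis vertex.
    refine c.hasK4Projection_of_cycle (m := m) hm
      (b := fun i => if i = 0 then w else p (2 * (i - 1) + 1)) (y := fun i => p (2 * i))
      ?_ hwp ?_ ?_ ?_
    · intro i hi
      split_ifs with h
      · exact hwB
      · exact hwp' (i - 1) (by omega)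
    · have hne : ∀ i, i ≠ 0 → i ≤ m → w ≠ p (2 * (i - 1) + 1) := by
        intro i hi him heq
        have h1 := (hw 0 (by omega)).2 (Or.inl rfl)
        have h2 := (hw (2 * m) le_rfl).2 (Or.inr rfl)
        rw [heq, hadj _ (by omega) _ (by omega)] at h1 h2
        omega
      intro i hi j hj hij
      split_ifs at hij with h1 h2 h2
      · omega
      · exact absurd hij (hne j h2 hj)
      · exact absurd hij.symm (hne i h1 hi)
      · have := hinj _ (by omega) _ (by omega) hij
        omega
    · intro i hi j hj
      split_ifs with h
      · rw [hw _ (by omega)]; omega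
      · rw [hadj _ (by omega) _ (by omega)]; omega
    · intro j hj
      split_ifs with h
      · rw [hw _ (by omega)]; omega
      · rw [hadj _ (by omega) _ (by omega)]; omega
  · have hwp : ∀ i ≤ m, p (2 * i) ∈ c.B := fun i hi => ((hpar i).1 (by omega)).2 hwB
    have hwp' : ∀ i < m, p (2 * i + 1) ∉ c.B := fun i hi => by
      have := (hpar i).2 (by omega)
      tauto
    refine c.hasK4Projection_of_cycle (m := m) hm
      (b := fun i => p (2 * i)) (y := fun i => if i = m then w else p (2 * i + 1)) hwp ?_ ?_ ?_ ?_
    · intro i hi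
      split_ifs with h
      · exact hwB
      · exact hwp' i (by omega)
    · intro i hi j hj hij
      have := hinj _ (by omega) _ (by omega) hij
      omega
    · intro i hi j hj
      rw [if_neg hi.ne, hadj _ (by omega) _ (by omega)]
      omega
    · intro j hj
      rw [if_pos rfl, SimpleGraph.adj_comm, hw _ (by omega)]
      omega

end CoordinateSystem

/-- A nonempty binary vector configuration without a projection onto `M(K₄)` has a loop, a coloop,
a parallel pair or a series pair. -/
theorem exists_series_or_parallel_pair {W ι : Type*} [AddCommGroup W] [Module (ZMod 2) W] [Finite ι]
    [Nonempty ι] {v : ι → W} (h : ¬ HasK4Projection (Set.range v)) :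
    (∃ e, v e = 0) ∨ (∃ e, ∃ l : W →ₗ[ZMod 2] ZMod 2, l (v e) = 1 ∧ ∀ g, g ≠ e → l (v g) = 0) ∨
      ∃ e f, e ≠ f ∧ (v e = v f ∨ ∃ l : W →ₗ[ZMod 2] ZMod 2, l (v e) = 1 ∧ l (v f) = 1 ∧
        ∀ g, g ≠ e → g ≠ f → l (v g) = 0) := by
  classical
  obtain ⟨c, -⟩ := exists_coordinateSystem (linearIndepOn_empty (ZMod 2) v)
  have hv : ∀ e, ∑ x ∈ c.B, c.l x (v e) • v x = v e :=
    fun e => c.sum_eq _ (Submodule.subset_span ⟨e, rfl⟩)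
  obtain ⟨u⟩ := ‹Nonempty ι›
  by_cases hu : ∃ w, c.graph.Adj u w
  swap
  · push Not at hu
    -- An isolated vertex of the fundamental graph is a coloop if it lies in the basis and a loop
    -- otherwise.
    by_cases huB : u ∈ c.B
    · refine Or.inr (Or.inl ⟨u, c.l u, c.l_self u huB, fun g hg => ?_⟩)
      by_cases hgB : g ∈ c.B
      · exact c.l_of_ne u huB g hgB hg.symm
      · rw [c.l_eq_ite huB hgB, if_neg (hu g)]
    · refine Or.inl ⟨u, ?_⟩
      rw [← hv u]
      refine Finset.sum_eq_zero fun x hx => ?_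
      rw [c.l_eq_ite hx huB, if_neg fun h => hu x h.symm, zero_smul]
  obtain ⟨w, huw⟩ := hu
  obtain ⟨e, f, hef, hpt⟩ := SimpleGraph.exists_pendant_or_twins (side := (· ∈ c.B))
    (fun x y hxy => c.graph_side hxy) (mt c.hasK4Projection_of_domino h)
    (mt c.hasK4Projection_of_hole h) huw
  refine Or.inr (Or.inr ⟨e, f, hef, ?_⟩)
  rcases hpt with hp | ⟨⟨g₀, hg₀⟩, ht⟩
  · have hadj : c.graph.Adj e f := (hp f).2 rfl
    -- A pendant basis element has a coordinate functional supported on the pair; a pendant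
    -- non-basis element is equal, as a vector, to its only neighbour.
    by_cases he : e ∈ c.B
    · refine Or.inr ⟨c.l e, c.l_self e he, ((c.graph_adj_iff he).1 hadj).2, fun g hge hgf => ?_⟩
      by_cases hg : g ∈ c.B
      · exact c.l_of_ne e he g hg hge.symm
      · rw [c.l_eq_ite he hg, if_neg fun h => hgf ((hp g).1 h)]
    · left
      have hf : f ∈ c.B := not_not.1 (mt (c.graph_side hadj).2 he)
      rw [← hv e, Finset.sum_eq_single f]
      · rw [c.l_eq_ite hf he, if_pos hadj.symm, one_smul]
      · intro x hx hxf
        rw [c.l_eq_ite hx he, if_neg fun h => hxf ((hp x).1 h.symm), zero_smul]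
      · exact fun h => absurd hf h
  · have h1 := c.graph_side hg₀
    have h2 := c.graph_side ((ht g₀).1 hg₀)
    -- Twins lie on the same side. In the basis, `l e + l f` cancels on everything outside the pair;
    -- off the basis, equal coordinates mean equal vectors.
    by_cases he : e ∈ c.B
    · have hf : f ∈ c.B := by tauto
      refine Or.inr ⟨c.l e + c.l f, ?_, ?_, fun g hge hgf => ?_⟩
      · simp [c.l_self e he, c.l_of_ne f hf e he hef.symm]
      · simp [c.l_self f hf, c.l_of_ne e he f hf hef]
      · by_cases hg : g ∈ c.B
        · simp [c.l_of_ne e he g hg hge.symm, c.l_of_ne f hf g hg hgf.symm]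
        · rw [LinearMap.add_apply, c.l_eq_ite he hg, c.l_eq_ite hf hg]
          simp only [ht g]
          split_ifs <;> rfl
    · left
      have hf : f ∉ c.B := by tauto
      rw [← hv e, ← hv f]
      refine Finset.sum_congr rfl fun x hx => ?_
      rw [c.l_eq_ite hx he, c.l_eq_ite hx hf]
      simp only [c.graph.adj_comm x, ht x]

/-! ### Projections under contraction and series extension -/

section Projection

variable {W W' : Type*} [AddCommGroup W] [Module (ZMod 2) W] [AddCommGroup W'] [Module (ZMod 2) W']

/-- Since `l u = 1` in characteristic two, `w ↦ w + l w • u` is not invertible: it is the projection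
along `u` onto the kernel of `l`. It contracts `u` without leaving `W`. -/
theorem LinearMap.transvection_eq_zero_iff {l : W →ₗ[ZMod 2] ZMod 2} {u : W} (hl : l u = 1)
    {w : W} : LinearMap.transvection l u w = 0 ↔ w ∈ Submodule.span (ZMod 2) {u} := by
  rw [LinearMap.transvection.apply, Submodule.mem_span_singleton]
  constructor
  · intro h
    refine ⟨l w, ?_⟩
    have h1 := add_self_eq_zero_of_zmod_two (l w • u)
    exact add_right_cancel (h1.trans h.symm)
  · rintro ⟨a, rfl⟩
    rw [map_smul, hl, smul_eq_mul, mul_one, add_self_eq_zero_of_zmod_two]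

namespace Matroid

variable {α : Type*} {v : α → W} {E : Set α}

theorem ofVectors_contract_singleton {f : α} (hf : f ∈ E) {l : W →ₗ[ZMod 2] ZMod 2}
    (hl : l (v f) = 1) : (ofVectors (ZMod 2) v E).contract {f} =
      ofVectors (ZMod 2) (LinearMap.transvection l (v f) ∘ v) (E \ {f}) := by
  refine ofVectors_contract (Set.singleton_subset_iff.2 hf) fun w _ => ?_
  rw [Set.image_singleton, LinearMap.transvection_eq_zero_iff hl]

end Matroid

theorem HasK4Projection.congr {S T : Set W} (h : ∀ s, s ≠ 0 → (s ∈ S ↔ s ∈ T))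
    (hS : HasK4Projection S) : HasK4Projection T := by
  have hspan : ∀ {S T : Set W}, (∀ s, s ≠ 0 → (s ∈ S ↔ s ∈ T)) →
      Submodule.span (ZMod 2) S ≤ Submodule.span (ZMod 2) T := by
    intro S T h
    rw [Submodule.span_le]
    intro s hs
    by_cases h0 : s = 0
    · rw [h0]; exact Submodule.zero_mem _
    · exact Submodule.subset_span ((h s h0).1 hs)
  obtain ⟨φ, hker, t, ht⟩ := hS
  refine ⟨φ, fun w hw h0 => ?_, t, fun z hz hzt => ?_⟩
  · refine hspan (fun s hs => ?_) (hker w (hspan (fun s hs => (h s hs).symm) hw) h0)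
    rw [Set.mem_inter_iff, Set.mem_inter_iff, h s hs]
  · obtain ⟨s, hs, hsz⟩ := ht z hz hzt
    have hs0 : s ≠ 0 := by rintro rfl; exact hz (by rw [← hsz, map_zero])
    exact ⟨s, (h s hs0).1 hs, hsz⟩

/-- Compose with `L`. A vector killed by the composite agrees modulo the kernel of `L` with a
combination of elements of `S` killed by it, and the kernel of `L` is itself spanned by elements of
`S`. -/
theorem HasK4Projection.of_image {S : Set W} {L : W →ₗ[ZMod 2] W'}
    (hL : ∀ w ∈ Submodule.span (ZMod 2) S, L w = 0 →
      w ∈ Submodule.span (ZMod 2) (S ∩ {s | L s = 0}))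
    (h : HasK4Projection (L '' S)) : HasK4Projection S := by
  obtain ⟨φ, hker, t, ht⟩ := h
  refine ⟨φ ∘ₗ L, fun w hw h0 => ?_, t, fun z hz hzt => ?_⟩
  · have h1 : L w ∈ Submodule.span (ZMod 2) (L '' S ∩ {s | φ s = 0}) := by
      refine hker _ ?_ h0
      rw [Submodule.span_image]
      exact ⟨w, hw, rfl⟩
    have h2 : L '' S ∩ {s | φ s = 0} ⊆ L '' (S ∩ {s | (φ ∘ₗ L) s = 0}) := by
      rintro _ ⟨⟨s, hs, rfl⟩, h0⟩
      exact ⟨s, ⟨hs, h0⟩, rfl⟩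
    have h3 := Submodule.span_mono h2 h1
    rw [Submodule.span_image] at h3
    obtain ⟨w', hw', hww'⟩ := h3
    have h4 : w - w' ∈ Submodule.span (ZMod 2) (S ∩ {s | L s = 0}) := by
      refine hL _ (Submodule.sub_mem _ hw (Submodule.span_mono Set.inter_subset_left hw')) ?_
      rw [map_sub, hww', sub_self]
    have h5 : S ∩ {s | L s = 0} ⊆ S ∩ {s | (φ ∘ₗ L) s = 0} := fun s hs =>
      ⟨hs.1, by simp [show L s = 0 from hs.2]⟩
    rw [← sub_add_cancel w w']
    exact Submodule.add_mem _ (Submodule.span_mono h5 h4) hw'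
  · obtain ⟨_, ⟨s, hs, rfl⟩, hsz⟩ := ht z hz hzt
    exact ⟨s, hs, hsz⟩

/-- For `z₁ = z` and `z₂ = P + z` the forbidden values of `z` are `0`, `t`, `P`, `Q`, `P + t` and `P
+ Q`: at most six of the eight vectors. -/
theorem exists_add_eq_avoiding (P Q t : Fin 3 → ZMod 2) :
    ∃ z₁ z₂, z₁ + z₂ = P ∧ (z₁ ≠ 0 ∧ z₁ ≠ t ∧ z₁ ≠ P ∧ z₁ ≠ Q) ∧
      z₂ ≠ 0 ∧ z₂ ≠ t ∧ z₂ ≠ P ∧ z₂ ≠ Q := by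
  obtain ⟨z, -, hz⟩ := Finset.exists_mem_notMem_of_card_lt_card
    (s := {0, t, P, Q, P + t, P + Q}) (t := (Finset.univ : Finset (Fin 3 → ZMod 2)))
    (lt_of_le_of_lt Finset.card_le_six (by decide))
  simp only [Finset.mem_insert, Finset.mem_singleton, not_or] at hz
  obtain ⟨h0, ht, hP', hQ, hPt, hPQ⟩ := hz
  have key : ∀ a, P + z = a → z = P + a := by
    rintro a rfl
    rw [← add_assoc, add_self_eq_zero_of_zmod_two, zero_add]
  refine ⟨z, P + z, ?_, ⟨h0, ht, hP', hQ⟩, fun h => hP' (by simpa using key _ h),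
    fun h => hPt (key _ h), fun h => h0 ?_, fun h => hPQ (key _ h)⟩
  · rw [add_comm P, ← add_assoc, add_self_eq_zero_of_zmod_two, zero_add]
  · rw [key _ h, add_self_eq_zero_of_zmod_two]

/-- A projection that kills `p` factors through the contraction of `p`, so it is enough to find one.
If the given map kills `q` instead, exchange the two; if it kills neither, `l` vanishes on its
kernel, which is impossible. -/
theorem HasK4Projection.image_transvection {S : Set W} {p q : W} {l m : W →ₗ[ZMod 2] ZMod 2}
    (hp : p ∈ S) (hq : q ∈ S) (hlp : l p = 1) (hlq : l q = 1)
    (hl : ∀ s ∈ S, s ≠ p → s ≠ q → l s = 0) (hm : m p = 1) (h : HasK4Projection S) :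
    HasK4Projection (LinearMap.transvection m p '' S) := by
  suffices h' : ∃ φ : W →ₗ[ZMod 2] (Fin 3 → ZMod 2),
      (∀ w ∈ Submodule.span (ZMod 2) S, φ w = 0 →
        w ∈ Submodule.span (ZMod 2) (S ∩ {s | φ s = 0})) ∧
      (∃ t, ∀ z, z ≠ 0 → z ≠ t → ∃ s ∈ S, φ s = z) ∧ φ p = 0 by
    obtain ⟨φ, hker, ⟨t, ht⟩, hφp⟩ := h'
    have hφ : ∀ w, φ (LinearMap.transvection m p w) = φ w := fun w => by
      rw [LinearMap.transvection.apply, map_add, map_smul, hφp, smul_zero, add_zero]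
    refine ⟨φ, fun w hw h0 => ?_, t, fun z hz hzt => ?_⟩
    · rw [Submodule.span_image] at hw
      obtain ⟨w, hw, rfl⟩ := hw
      rw [hφ] at h0
      have h1 := Submodule.mem_map_of_mem (f := LinearMap.transvection m p) (hker w hw h0)
      rw [← Submodule.span_image] at h1
      refine Submodule.span_mono ?_ h1
      rintro _ ⟨s, ⟨hs, hs0⟩, rfl⟩
      exact ⟨⟨s, hs, rfl⟩, (hφ s).trans hs0⟩
    · obtain ⟨s, hs, hsz⟩ := ht z hz hzt
      exact ⟨_, ⟨s, hs, rfl⟩, (hφ s).trans hsz⟩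
  obtain ⟨φ, hker, t, ht⟩ := h
  by_cases hφp : φ p = 0
  · exact ⟨φ, hker, ⟨t, ht⟩, hφp⟩
  by_cases hφq : φ q = 0
  -- Here `l (p + q) = 0`, so this is a genuine transvection: an involution that swaps `p` and `q`
  -- and fixes the other elements of `S`.
  · set T := LinearMap.transvection l (p + q) with hT
    have hlpq : l (p + q) = 0 := by rw [map_add, hlp, hlq]; rfl
    have hTp : T p = q := by
      rw [hT, LinearMap.transvection.apply, hlp, one_smul, ← add_assoc,
        add_self_eq_zero_of_zmod_two, zero_add]
    have hTq : T q = p := by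
      rw [hT, LinearMap.transvection.apply, hlq, one_smul, add_comm p, ← add_assoc,
        add_self_eq_zero_of_zmod_two, zero_add]
    have hTS : ∀ s ∈ S, T s ∈ S := by
      intro s hs
      by_cases hsp : s = p
      · rwa [hsp, hTp]
      by_cases hsq : s = q
      · rwa [hsq, hTq]
      rwa [hT, LinearMap.transvection.apply, hl s hs hsp hsq, zero_smul, add_zero]
    have hTT : ∀ w, T (T w) = w := by
      intro w
      rw [hT, LinearMap.transvection.apply, LinearMap.transvection.apply, map_add, map_smul, hlpq,
        smul_zero, add_zero, add_assoc, add_self_eq_zero_of_zmod_two, add_zero]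
    refine ⟨φ ∘ₗ T, fun w hw h0 => ?_, ⟨t, fun z hz hzt => ?_⟩, ?_⟩
    · have h1 : T w ∈ Submodule.span (ZMod 2) S := by
        have h2 := Submodule.mem_map_of_mem (f := T) hw
        rw [← Submodule.span_image] at h2
        refine Submodule.span_mono ?_ h2
        rintro _ ⟨s, hs, rfl⟩
        exact hTS s hs
      have h2 := Submodule.mem_map_of_mem (f := T) (hker _ h1 h0)
      rw [← Submodule.span_image, hTT] at h2
      refine Submodule.span_mono ?_ h2
      rintro _ ⟨s, ⟨hs, hs0⟩, rfl⟩
      exact ⟨hTS s hs, by simpa [hTT] using hs0⟩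
    · obtain ⟨s, hs, hsz⟩ := ht z hz hzt
      exact ⟨T s, hTS s hs, by simpa [hTT] using hsz⟩
    · simpa [hTp] using hφq
  exfalso
  have hlker : ∀ w ∈ Submodule.span (ZMod 2) S, φ w = 0 → l w = 0 := by
    intro w hw h0
    have h1 : Submodule.span (ZMod 2) (S ∩ {s | φ s = 0}) ≤ LinearMap.ker l := by
      rw [Submodule.span_le]
      rintro s ⟨hs, hs0⟩
      exact hl s hs (by rintro rfl; exact hφp hs0) (by rintro rfl; exact hφq hs0)
    exact h1 (hker w hw h0)
  -- Write `φ p` as a sum of two covered values different from `φ p` and `φ q`. Preimages `s₁`, `s₂`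
  -- then avoid the pair, and `s₁ + s₂ + p` lies in the kernel although `l` takes the value one on
  -- it.
  obtain ⟨z₁, z₂, hz, ⟨h10, h1t, h1p, h1q⟩, h20, h2t, h2p, h2q⟩ :=
    exists_add_eq_avoiding (φ p) (φ q) t
  obtain ⟨s₁, hs₁, rfl⟩ := ht z₁ h10 h1t
  obtain ⟨s₂, hs₂, rfl⟩ := ht z₂ h20 h2t
  have hl₁ := hl s₁ hs₁ (by rintro rfl; exact h1p rfl) (by rintro rfl; exact h1q rfl)
  have hl₂ := hl s₂ hs₂ (by rintro rfl; exact h2p rfl) (by rintro rfl; exact h2q rfl)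
  have h1 := hlker (s₁ + s₂ + p) (Submodule.add_mem _ (Submodule.add_mem _
    (Submodule.subset_span hs₁) (Submodule.subset_span hs₂)) (Submodule.subset_span hp))
    (by rw [map_add, map_add, hz, add_self_eq_zero_of_zmod_two])
  rw [map_add, map_add, hl₁, hl₂, hlp] at h1
  exact absurd h1 (by decide)

/-- Keeping or deleting the contracted element makes no difference, since its image is zero. -/
theorem mem_image_transvection_iff {α : Type*} {v : α → W} {E : Set α} {f : α}
    {l : W →ₗ[ZMod 2] ZMod 2} (hl : l (v f) = 1) (s : W) (hs : s ≠ 0) :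
    s ∈ LinearMap.transvection l (v f) '' (v '' E) ↔
      s ∈ (LinearMap.transvection l (v f) ∘ v) '' (E \ {f}) := by
  constructor
  · rintro ⟨_, ⟨g, hg, rfl⟩, rfl⟩
    refine ⟨g, ⟨hg, ?_⟩, rfl⟩
    rintro rfl
    exact hs ((LinearMap.transvection_eq_zero_iff hl).2 (Submodule.mem_span_singleton_self _))
  · rintro ⟨g, hg, rfl⟩
    exact ⟨_, ⟨g, hg.1, rfl⟩, rfl⟩

theorem HasK4Projection.of_contract {α : Type*} {v : α → W} {E : Set α} {f : α} (hf : f ∈ E)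
    {l : W →ₗ[ZMod 2] ZMod 2} (hl : l (v f) = 1)
    (h : HasK4Projection ((LinearMap.transvection l (v f) ∘ v) '' (E \ {f}))) :
    HasK4Projection (v '' E) := by
  refine HasK4Projection.of_image (L := LinearMap.transvection l (v f)) (fun w _ h0 => ?_)
    (h.congr fun s hs => (mem_image_transvection_iff hl s hs).symm)
  refine Submodule.span_mono ?_ ((LinearMap.transvection_eq_zero_iff hl).1 h0)
  rw [Set.singleton_subset_iff]
  exact ⟨⟨f, hf, rfl⟩,
    (LinearMap.transvection_eq_zero_iff hl).2 (Submodule.mem_span_singleton_self _)⟩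

end Projection

/-! ### Graphs of series and parallel extensions -/

namespace Graph

variable {V E : Type*}

theorem incVec_single_edge_ne {G : Graph V E} {e : E} {x y : V} (h : G.IsLink e x y) (hxy : x ≠ y) :
    G.incVec e ≠ 0 := by
  rw [h.incVec_eq]
  intro h0
  have := DFunLike.congr_fun h0 x
  simp [hxy] at this

theorem incVec_eq_zero_of_eq {G : Graph V E} {e : E} {x : V} (h : G.IsLink e x x) :
    G.incVec e = 0 := by
  rw [h.incVec_eq, single_add_single_self]

theorem incVec_deleteEdges {G : Graph V E} {e f : E} (he : e ∈ G.edgeSet) (hef : e ≠ f) :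
    (G.deleteEdges {f}).incVec e = G.incVec e := by
  obtain ⟨x, y, hxy⟩ := G.exists_isLink_of_mem_edgeSet he
  have h : (G.deleteEdges {f}).IsLink e x y := by
    rw [deleteEdges_isLink]
    exact ⟨hxy, hef⟩
  rw [h.incVec_eq, hxy.incVec_eq]

theorem cycleMatroid_deleteEdges (G : Graph V E) (f : E) :
    (G.deleteEdges {f}).cycleMatroid = G.cycleMatroid.delete {f} := by
  rw [cycleMatroid_eq_ofVectors, cycleMatroid_eq_ofVectors, Matroid.delete_eq_restrict,
    Matroid.ofVectors_ground, Matroid.ofVectors_restrict Set.sdiff_subset]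
  exact Matroid.ofVectors_congr fun e he => incVec_deleteEdges he.1 he.2

/-- Identifying `y` with `x` moves the coordinate at `y` to `x`, that is, adds `x + y` whenever that
coordinate is one. -/
theorem incVec_map_update [DecidableEq V] {G : Graph V E} {f : E} {x y : V} (hf : G.IsLink f x y)
    {e : E} (he : e ∈ G.edgeSet) (hef : e ≠ f) :
    ((G.deleteEdges {f}).map (Function.update id y x)).incVec e =
      LinearMap.transvection (Finsupp.lapply y) (G.incVec f) (G.incVec e) := by
  obtain ⟨a, b, hab⟩ := G.exists_isLink_of_mem_edgeSet he
  have h : (G.deleteEdges {f}).IsLink e a b := by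
    rw [deleteEdges_isLink]
    exact ⟨hab, hef⟩
  have key : ∀ c, LinearMap.transvection (Finsupp.lapply y) (G.incVec f) (Finsupp.single c 1) =
      Finsupp.single (Function.update id y x c) 1 := by
    intro c
    rw [LinearMap.transvection.apply, hf.incVec_eq, Finsupp.lapply_apply]
    by_cases hc : c = y
    · subst hc
      rw [Finsupp.single_eq_same, one_smul, Function.update_self, add_comm (Finsupp.single x 1),
        ← add_assoc, single_add_single_self, zero_add]
    · rw [Finsupp.single_eq_of_ne (Ne.symm hc), zero_smul, add_zero, Function.update_of_ne hc, id]
  rw [(h.map (Function.update id y x)).incVec_eq, hab.incVec_eq, map_add, key, key]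

theorem IsEdgeContraction.exists_ofVectors {G H : Graph V E} {f : E} (h : G.IsEdgeContraction H f)
    (hf : H.incVec f ≠ 0) : ∃ l : (V →₀ ZMod 2) →ₗ[ZMod 2] ZMod 2, l (H.incVec f) = 1 ∧
      G.edgeSet = H.edgeSet \ {f} ∧
      ∀ e ∈ G.edgeSet, G.incVec e = LinearMap.transvection l (H.incVec f) (H.incVec e) := by
  classical
  obtain ⟨x, y, hl, rfl⟩ := h
  have hxy : x ≠ y := by
    rintro rfl
    exact hf (incVec_eq_zero_of_eq hl)
  refine ⟨Finsupp.lapply y, ?_, rfl, fun e he => ?_⟩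
  · rw [hl.incVec_eq, Finsupp.lapply_apply]
    simp [hxy]
  · convert! incVec_map_update hl he.1 he.2

theorem IsEdgeContraction.cycleMatroid_eq {G H : Graph V E} {f : E} (h : G.IsEdgeContraction H f)
    (hfE : f ∈ H.edgeSet) (hf : H.incVec f ≠ 0) :
    G.cycleMatroid = H.cycleMatroid.contract {f} := by
  obtain ⟨l, hl, hE, hv⟩ := h.exists_ofVectors hf
  rw [cycleMatroid_eq_ofVectors, cycleMatroid_eq_ofVectors,
    Matroid.ofVectors_contract_singleton hfE hl, hE]
  exact Matroid.ofVectors_congr fun e he => hv e (hE ▸ he)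

/-- Add the edge `f` with ends `x` and `y`, after removing it if it is already there. -/
def setEdge (G : Graph V E) (f : E) (x y : V) : Graph V E where
  vertexSet := insert x (insert y G.vertexSet)
  edgeSet := insert f G.edgeSet
  IsLink e a b := e ≠ f ∧ G.IsLink e a b ∨ e = f ∧ (a = x ∧ b = y ∨ a = y ∧ b = x)
  isLink_symm := by
    intro e _
    refine ⟨fun a b h => ?_⟩
    rcases h with ⟨h1, h2⟩ | ⟨h1, h2⟩
    · exact Or.inl ⟨h1, h2.symm⟩
    · exact Or.inr ⟨h1, by tauto⟩
  eq_or_eq_of_isLink_of_isLink := by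
    rintro e a b c d (⟨h1, h2⟩ | ⟨h1, h2⟩) (⟨h3, h4⟩ | ⟨h3, h4⟩)
    · exact h2.left_eq_or_eq h4
    · exact absurd h3 h1
    · exact absurd h1 h3
    · rcases h2 with ⟨rfl, rfl⟩ | ⟨rfl, rfl⟩ <;> rcases h4 with ⟨rfl, rfl⟩ | ⟨rfl, rfl⟩ <;> simp
  edge_mem_iff_exists_isLink := by
    intro e
    by_cases he : e = f
    · simp only [he, Set.mem_insert_iff, true_or, true_iff]
      exact ⟨x, y, by simp⟩
    · simp [he, G.edge_mem_iff_exists_isLink]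
  left_mem_of_isLink := by
    rintro e a b (⟨h1, h2⟩ | ⟨h1, ⟨rfl, rfl⟩ | ⟨rfl, rfl⟩⟩)
    · exact Or.inr (Or.inr h2.left_mem)
    · exact Or.inl rfl
    · exact Or.inr (Or.inl rfl)

theorem setEdge_isLink_self (G : Graph V E) (f : E) (x y : V) : (G.setEdge f x y).IsLink f x y :=
  Or.inr ⟨rfl, Or.inl ⟨rfl, rfl⟩⟩

theorem setEdge_isLink_of_ne {G : Graph V E} {e f : E} {x y a b : V} (h : e ≠ f) :
    (G.setEdge f x y).IsLink e a b ↔ G.IsLink e a b := by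
  simp [setEdge, h]

theorem deleteEdges_setEdge {G : Graph V E} {f : E} {x y : V} (hf : f ∉ G.edgeSet)
    (hx : x ∈ G.vertexSet) (hy : y ∈ G.vertexSet) : (G.setEdge f x y).deleteEdges {f} = G := by
  refine Graph.ext ?_ fun e a b => ?_
  · change insert x (insert y G.vertexSet) = G.vertexSet
    rw [Set.insert_eq_of_mem hy, Set.insert_eq_of_mem hx]
  · rw [deleteEdges_isLink]
    by_cases he : e = f
    · subst he
      simp [hf]
    · simp [setEdge_isLink_of_ne he, he]

/-- Subdivide the edge `e` with ends `x` and `y`: the edge `e` now joins `x` to the new vertex `z`,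
and the new edge `f` joins `y` to `z`. -/
def subdivide (G : Graph V E) (e f : E) (x y z : V) : Graph V E := (G.setEdge e x z).setEdge f y z

theorem isEdgeContraction_subdivide {G : Graph V E} {e f : E} {x y z : V} (hef : e ≠ f)
    (hf : f ∉ G.edgeSet) (hz : z ∉ G.vertexSet) (he : G.IsLink e x y) :
    G.IsEdgeContraction (G.subdivide e f x y z) f := by
  classical
  refine ⟨y, z, setEdge_isLink_self _ _ _ _, ?_⟩
  have hne : ∀ a ∈ G.vertexSet, a ≠ z := fun a ha h => hz (h ▸ ha)
  refine Graph.ext ?_ fun g a b => ?_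
  · change _ = _ '' insert y (insert z (insert x (insert z G.vertexSet)))
    ext a
    simp only [Set.mem_image, Set.mem_insert_iff]
    constructor
    · intro ha
      exact ⟨a, by simp [ha], by rw [Function.update_of_ne (hne a ha)]; rfl⟩
    · rintro ⟨b, hb, rfl⟩
      by_cases hbz : b = z
      · rw [hbz, Function.update_self]; exact he.right_mem
      · rw [Function.update_of_ne hbz]
        rcases hb with rfl | hb | rfl | hb | hb
        · exact he.right_mem
        · exact absurd hb hbz
        · exact he.left_mem
        · exact absurd hb hbz
        · exact hb
  · rw [map_isLink]
    have hupd : ∀ {a}, a ≠ z → Function.update id z y a = a := fun h => by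
      rw [Function.update_of_ne h]; rfl
    constructor
    · intro hg
      have hgf : g ≠ f := by rintro rfl; exact hf hg.edge_mem
      by_cases hge : g = e
      · subst hge
        have hl : ((G.subdivide g f x y z).deleteEdges {f}).IsLink g x z := by
          rw [deleteEdges_isLink]
          exact ⟨(setEdge_isLink_of_ne hgf).2 (setEdge_isLink_self _ _ _ _), hgf⟩
        rcases hg.eq_and_eq_or_eq_and_eq he with ⟨rfl, rfl⟩ | ⟨rfl, rfl⟩
        · exact ⟨_, _, hl, hupd (hne _ hg.left_mem), Function.update_self _ _ _⟩
        · exact ⟨_, _, hl.symm, Function.update_self _ _ _, hupd (hne _ hg.right_mem)⟩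
      · refine ⟨a, b, ?_, hupd (hne _ hg.left_mem), hupd (hne _ hg.right_mem)⟩
        rw [deleteEdges_isLink]
        exact ⟨(setEdge_isLink_of_ne hgf).2 ((setEdge_isLink_of_ne hge).2 hg), hgf⟩
    · rintro ⟨a, b, hl, rfl, rfl⟩
      rw [deleteEdges_isLink] at hl
      have hgf : g ≠ f := hl.2
      have hl' := (setEdge_isLink_of_ne hgf).1 hl.1
      by_cases hge : g = e
      · subst hge
        rcases hl'.eq_and_eq_or_eq_and_eq (setEdge_isLink_self _ _ _ _) with ⟨rfl, rfl⟩ | ⟨rfl, rfl⟩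
        · rwa [Function.update_self, hupd (hne _ he.left_mem)]
        · rw [Function.update_self, hupd (hne _ he.left_mem)]
          exact he.symm
      · have hl'' := (setEdge_isLink_of_ne hge).1 hl'
        rwa [hupd (hne _ hl''.left_mem), hupd (hne _ hl''.right_mem)]

end Graph

/-! ### Series-parallel networks have no projection onto `M(K₄)` -/

theorem not_hasK4Projection_singleton {W : Type*} [AddCommGroup W] [Module (ZMod 2) W] (s : W) :
    ¬ HasK4Projection {s} := by
  rintro ⟨φ, -, t, ht⟩
  obtain ⟨z₁, z₂, hz, ⟨h10, h1t, h1p, -⟩, -⟩ := exists_add_eq_avoiding (φ s) (φ s) t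
  obtain ⟨_, rfl, hs⟩ := ht z₁ h10 h1t
  exact h1p hs.symm

/-- A single edge provides one vector, too few for a projection. A parallel extension repeats a
vector, and a projection after a series extension would descend to the contraction. -/
theorem Graph.IsSeriesParallelNetwork.isConnected_and_not_hasK4Projection {V E : Type*}
    {G : Graph V E} (h : G.IsSeriesParallelNetwork) :
    G.cycleMatroid.IsConnected ∧ ¬ HasK4Projection (G.incVec '' G.edgeSet) := by
  induction h with
  | @single G e x y hl hE hV =>
    refine ⟨⟨⟨e, hl.edge_mem⟩, fun a ha b hb hab => ?_⟩, ?_⟩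
    · have ha' : a ∈ G.edgeSet := ha
      have hb' : b ∈ G.edgeSet := hb
      rw [hE] at ha' hb'
      exact absurd (ha'.trans hb'.symm) hab
    · rw [hE, Set.image_singleton]
      exact not_hasK4Projection_singleton _
  | @parallel G H f g x y hG hfg hxy hf hg hGH ih =>
    subst hGH
    have hfg' : H.incVec g = H.incVec f := by rw [hf.incVec_eq, hg.incVec_eq]
    constructor
    · refine Matroid.IsConnected.of_delete_parallel (e := g) (f := f) ?_ hfg.symm ?_
      · rw [Graph.cycleMatroid_eq_ofVectors]
        exact Matroid.ofVectors_parallel hg.edge_mem hf.edge_mem hfg.symm hfg'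
          (Graph.incVec_single_edge_ne hg hxy)
      · rw [← Graph.cycleMatroid_deleteEdges]
        exact ih.1
    · convert! ih.2 using 2
      ext w
      constructor
      · rintro ⟨e, he, rfl⟩
        by_cases hef : e = f
        · exact ⟨g, ⟨hg.edge_mem, hfg.symm⟩, by
            rw [Graph.incVec_deleteEdges hg.edge_mem hfg.symm, hfg', hef]⟩
        · exact ⟨e, ⟨he, hef⟩, Graph.incVec_deleteEdges he hef⟩
      · rintro ⟨e, he, rfl⟩
        exact ⟨e, he.1, (Graph.incVec_deleteEdges he.1 he.2).symm⟩
  | @series G H f g hG hfg hser hGH ih =>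
    have hser' := hser
    rw [Graph.cycleMatroid_eq_ofVectors] at hser'
    obtain ⟨l, hlf, hlg, hl⟩ := Matroid.exists_functional_of_isCocircuit_pair hser' hfg
    have hf0 : H.incVec f ≠ 0 := fun h0 => by
      rw [h0, map_zero] at hlf
      exact zero_ne_one hlf
    have hfE : f ∈ H.edgeSet := hser.subset_ground (by simp)
    have hgE : g ∈ H.edgeSet := hser.subset_ground (by simp)
    constructor
    · rw [Set.pair_comm] at hser
      refine Matroid.IsConnected.of_contract_series hser hfg.symm ?_
      rw [← hGH.cycleMatroid_eq hfE hf0]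
      exact ih.1
    · intro hK
      obtain ⟨m, hm, hE, hv⟩ := hGH.exists_ofVectors hf0
      refine ih.2 ?_
      have h1 : HasK4Projection (LinearMap.transvection m (H.incVec f) ''
          (H.incVec '' H.edgeSet)) := by
        refine hK.image_transvection (q := H.incVec g) ⟨f, hfE, rfl⟩ ⟨g, hgE, rfl⟩ hlf hlg ?_ hm
        rintro _ ⟨e, he, rfl⟩ hef heg
        exact hl e he (by rintro rfl; exact hef rfl) (by rintro rfl; exact heg rfl)
      have h2 := h1.congr fun s hs => mem_image_transvection_iff hm s hs
      rw [← hE] at h2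
      convert! h2 using 1
      exact Set.image_congr fun e he => hv e he

/-! ### Constructing series-parallel networks -/

namespace Matroid

theorem eq_of_ground_eq_singleton {α : Type*} {M N : Matroid α} {e : α} (hM : M.E = {e})
    (hN : N.E = {e}) (h : M.IsLoop e ↔ N.IsLoop e) : M = N := by
  refine ext_indep (hM.trans hN.symm) fun I hI => ?_
  rw [hM, Set.subset_singleton_iff_eq] at hI
  rcases hI with rfl | rfl
  · simp
  · rw [indep_singleton, indep_singleton, ← not_isLoop_iff (by simp [hM]),
      ← not_isLoop_iff (by simp [hN]), h]

variable {W α : Type*} [AddCommGroup W] [Module (ZMod 2) W]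

theorem ofVectors_eq_cycleMatroid_singleton (v : α → W) (e : α) :
    ∃ G : Graph ℕ α, G.vertexSet.Finite ∧ G.IsSeriesParallelNetwork ∧
      ofVectors (ZMod 2) v {e} = G.cycleMatroid := by
  classical
  set y : ℕ := if v e = 0 then 0 else 1 with hy
  have hl : (Graph.banana 0 y {e}).IsLink e 0 y := by simp [Graph.banana_isLink]
  refine ⟨Graph.banana 0 y {e}, ?_, .single hl rfl rfl, ?_⟩
  · exact (Set.toFinite {0, y})
  · refine eq_of_ground_eq_singleton rfl rfl ?_
    rw [Graph.cycleMatroid_eq_ofVectors, ofVectors_isLoop_iff (Set.mem_singleton e),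
      ofVectors_isLoop_iff hl.edge_mem]
    by_cases h0 : v e = 0
    · rw [if_pos h0] at hy
      rw [hy] at hl ⊢
      simp [h0, Graph.incVec_eq_zero_of_eq hl]
    · rw [if_neg h0] at hy
      rw [hy] at hl ⊢
      simp [h0, Graph.incVec_single_edge_ne hl]

theorem exists_eq_cycleMatroid_of_parallel {v : α → W} {E : Set α} {e f : α} (he : e ∈ E)
    (hf : f ∈ E) (hef : e ≠ f) (hv : v e = v f) (h0 : v e ≠ 0) {G : Graph ℕ α}
    (hfin : G.vertexSet.Finite) (hG : G.IsSeriesParallelNetwork)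
    (hGE : ofVectors (ZMod 2) v (E \ {f}) = G.cycleMatroid) :
    ∃ H : Graph ℕ α, H.vertexSet.Finite ∧ H.IsSeriesParallelNetwork ∧
      ofVectors (ZMod 2) v E = H.cycleMatroid := by
  have hE : E \ {f} = G.edgeSet := congrArg Matroid.E hGE
  have heG : e ∈ G.edgeSet := hE ▸ (⟨he, hef⟩ : e ∈ E \ {f})
  have hfG : f ∉ G.edgeSet := fun h => by
    rw [← hE] at h
    exact h.2 rfl
  obtain ⟨x, y, hxy⟩ := G.exists_isLink_of_mem_edgeSet heG
  have hne : x ≠ y := by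
    rintro rfl
    have h1 : (ofVectors (ZMod 2) v (E \ {f})).IsLoop e := by
      rw [hGE, Graph.cycleMatroid_eq_ofVectors, ofVectors_isLoop_iff heG]
      exact Graph.incVec_eq_zero_of_eq hxy
    exact h0 ((ofVectors_isLoop_iff (show e ∈ E \ {f} from ⟨he, hef⟩)).1 h1)
  have hdel := Graph.deleteEdges_setEdge hfG hxy.left_mem hxy.right_mem
  have hf' := Graph.setEdge_isLink_self G f x y
  have he' : (G.setEdge f x y).IsLink e x y := (Graph.setEdge_isLink_of_ne hef).2 hxy
  refine ⟨G.setEdge f x y, (hfin.insert y).insert x,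
    .parallel hG hef.symm hne hf' he' hdel.symm, ?_⟩
  refine eq_of_delete_eq_of_isCircuit (ofVectors_parallel he hf hef hv h0) ?_ ?_
  · rw [Graph.cycleMatroid_eq_ofVectors]
    exact ofVectors_parallel he'.edge_mem hf'.edge_mem hef (by rw [he'.incVec_eq, hf'.incVec_eq])
      (Graph.incVec_single_edge_ne he' hne)
  · rw [← Graph.cycleMatroid_deleteEdges, hdel, ← hGE, delete_eq_restrict, ofVectors_ground,
      ofVectors_restrict Set.sdiff_subset]

theorem exists_eq_cycleMatroid_of_series {M : Matroid α} {e f : α} (hef : e ≠ f)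
    (hser : M.IsCocircuit {e, f}) {G : Graph ℕ α}
    (hfin : G.vertexSet.Finite) (hG : G.IsSeriesParallelNetwork)
    (hGE : M.contract {f} = G.cycleMatroid) :
    ∃ H : Graph ℕ α, H.vertexSet.Finite ∧ H.IsSeriesParallelNetwork ∧ M = H.cycleMatroid := by
  have he : e ∈ M.E := hser.subset_ground (by simp)
  have hE : M.E \ {f} = G.edgeSet := congrArg Matroid.E hGE
  have heG : e ∈ G.edgeSet := hE ▸ (⟨he, hef⟩ : e ∈ M.E \ {f})
  have hfG : f ∉ G.edgeSet := fun h => by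
    rw [← hE] at h
    exact h.2 rfl
  obtain ⟨x, y, hxy⟩ := G.exists_isLink_of_mem_edgeSet heG
  -- A fresh vertex for the subdivision; this is why vertices are natural numbers and finiteness of
  -- the vertex set is carried along.
  obtain ⟨z, hz⟩ := hfin.infinite_compl.nonempty
  have hcon := Graph.isEdgeContraction_subdivide hef hfG hz hxy
  have hxz : x ≠ z := fun h => hz (h ▸ hxy.left_mem)
  have hyz : y ≠ z := fun h => hz (h ▸ hxy.right_mem)
  set H := G.subdivide e f x y z with hH
  have hfH : H.IsLink f y z := Graph.setEdge_isLink_self _ _ _ _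
  have heH : H.IsLink e x z :=
    (Graph.setEdge_isLink_of_ne hef).2 (Graph.setEdge_isLink_self _ _ _ _)
  have hcM := hcon.cycleMatroid_eq hfH.edge_mem (Graph.incVec_single_edge_ne hfH hyz)
  -- A coloop `e` of the subdivided graph would be a coloop of the common contraction, hence of `M`,
  -- against `{e, f}` being a cocircuit.
  have hnc : ¬ H.cycleMatroid.IsColoop e := by
    intro h1
    have h2 : (M.contract {f}).IsColoop e := by
      rw [hGE, hcM, contract_isColoop_iff]
      exact ⟨h1, hef⟩
    have h3 := hser.eq_of_superset_isCircuit (contract_isColoop_iff.1 h2).1.isCocircuit (by simp)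
    have h4 : f ∈ ({e} : Set α) := h3 ▸ (by simp)
    exact hef h4.symm
  have hserH : H.cycleMatroid.IsCocircuit {e, f} := by
    rw [Graph.cycleMatroid_eq_ofVectors] at hnc ⊢
    refine ofVectors_isCocircuit_pair heH.edge_mem hfH.edge_mem hef hnc
      -- The star of the new vertex `z` consists of `e` and `f` only.
      (l := Finsupp.lapply z) ?_ ?_ ?_
    · rw [heH.incVec_eq, Finsupp.lapply_apply]
      simp [hxz]
    · rw [hfH.incVec_eq, Finsupp.lapply_apply]
      simp [hyz]
    · intro g hg hge hgf
      obtain ⟨a, b, hab⟩ := H.exists_isLink_of_mem_edgeSet hg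
      have hab' : G.IsLink g a b :=
        (Graph.setEdge_isLink_of_ne hge).1 ((Graph.setEdge_isLink_of_ne hgf).1 hab)
      have haz : a ≠ z := fun h => hz (h ▸ hab'.left_mem)
      have hbz : b ≠ z := fun h => hz (h ▸ hab'.right_mem)
      rw [hab.incVec_eq, Finsupp.lapply_apply]
      simp [haz, hbz]
  refine ⟨H, (((hfin.insert z).insert x).insert z).insert y,
    .series hG hef.symm (by rwa [Set.pair_comm]) hcon, ?_⟩
  exact eq_of_contract_eq_of_isCocircuit hser hserH (hGE.trans hcM)

theorem exists_eq_cycleMatroid_of_not_hasK4Projection (n : ℕ) : ∀ (v : α → W) (E : Set α),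
    E.Finite → E.ncard = n → (ofVectors (ZMod 2) v E).IsConnected → ¬ HasK4Projection (v '' E) →
    ∃ G : Graph ℕ α, G.vertexSet.Finite ∧ G.IsSeriesParallelNetwork ∧
      ofVectors (ZMod 2) v E = G.cycleMatroid := by
  induction n with
  | zero =>
    intro v E hE hn hconn _
    rw [Set.ncard_eq_zero hE] at hn
    exact absurd hconn.1 (by simp [hn])
  | succ n ih =>
    intro v E hE hn hconn hK
    obtain ⟨e₀, he₀⟩ := hconn.1
    by_cases hsing : ∀ e ∈ E, e = e₀
    · rw [(Set.eq_singleton_iff_unique_mem.2 ⟨he₀, hsing⟩ : E = {e₀})]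
      exact ofVectors_eq_cycleMatroid_singleton v e₀
    push Not at hsing
    obtain ⟨e₁, he₁, he₁₀⟩ := hsing
    -- With a second element available, connectedness rules out loops and coloops, leaving only a
    -- parallel or a series pair.
    have hother : ∀ e, ∃ f ∈ (ofVectors (ZMod 2) v E).E, e ≠ f := fun e => by
      by_cases he : e = e₀
      · exact ⟨e₁, he₁, by rw [he]; exact he₁₀.symm⟩
      · exact ⟨e₀, he₀, he⟩
    have hnoloop : ∀ e ∈ E, v e ≠ 0 := fun e he h0 => by
      obtain ⟨f, hf, hef⟩ := hother e
      exact hconn.not_isLoop hf hef ((ofVectors_isLoop_iff he).2 h0)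
    have hnocoloop : ∀ e, ¬ (ofVectors (ZMod 2) v E).IsColoop e := fun e => by
      obtain ⟨f, hf, hef⟩ := hother e
      exact hconn.not_isColoop hf hef
    have : Finite E := hE
    have : Nonempty E := ⟨⟨e₀, he₀⟩⟩
    have hK' : ¬ HasK4Projection (Set.range fun e : E => v e) := by
      rwa [← Set.image_eq_range]
    rcases exists_series_or_parallel_pair hK' with ⟨e, h0⟩ | ⟨e, l, hle, hl⟩ | ⟨e, f, hef, hpair⟩
    · exact absurd h0 (hnoloop e e.2)
    · refine absurd ((ofVectors_isColoop_iff e.2).2 fun hsp => ?_) (hnocoloop e)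
      have h1 : Submodule.span (ZMod 2) (v '' (E \ {(e : α)})) ≤ LinearMap.ker l := by
        rw [Submodule.span_le]
        rintro _ ⟨g, ⟨hg, hge⟩, rfl⟩
        exact hl ⟨g, hg⟩ fun h => hge (congrArg Subtype.val h)
      have h2 := h1 hsp
      rw [LinearMap.mem_ker, hle] at h2
      exact one_ne_zero h2
    obtain ⟨e, he⟩ := e
    obtain ⟨f, hf⟩ := f
    have hef' : e ≠ f := fun h => hef (Subtype.ext h)
    have hcard : (E \ {f}).ncard = n := by
      rw [Set.ncard_sdiff_singleton_of_mem hf, hn]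
      rfl
    rcases hpair with hpar | ⟨l, hle, hlf, hl⟩
    · have hpar : v e = v f := hpar
      have hcirc := ofVectors_parallel he hf hef' hpar (hnoloop e he)
      have hdel : (ofVectors (ZMod 2) v E).delete {f} = ofVectors (ZMod 2) v (E \ {f}) := by
        rw [delete_eq_restrict, ofVectors_ground, ofVectors_restrict Set.sdiff_subset]
      have himg : v '' (E \ {f}) = v '' E := by
        refine (Set.image_mono Set.sdiff_subset).antisymm ?_
        rintro _ ⟨g, hg, rfl⟩
        by_cases hgf : g = f
        · exact ⟨e, ⟨he, hef'⟩, by rw [hpar, hgf]⟩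
        · exact ⟨g, ⟨hg, hgf⟩, rfl⟩
      obtain ⟨G, hfin, hG, hGE⟩ := ih v (E \ {f}) hE.sdiff hcard
        (hdel ▸ hconn.delete_parallel hcirc hef') (himg ▸ hK)
      exact exists_eq_cycleMatroid_of_parallel he hf hef' hpar (hnoloop e he) hfin hG hGE
    · have hle : l (v e) = 1 := hle
      have hlf : l (v f) = 1 := hlf
      have hcoc := ofVectors_isCocircuit_pair he hf hef' (hnocoloop e) hle hlf
        fun g hg hge hgf => hl ⟨g, hg⟩ (fun h => hge (congrArg Subtype.val h))
          (fun h => hgf (congrArg Subtype.val h))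
      have hcon := ofVectors_contract_singleton hf hlf
      obtain ⟨G, hfin, hG, hGE⟩ := ih _ (E \ {f}) hE.sdiff hcard
        (hcon ▸ hconn.contract_series hcoc hef') (fun h => hK (h.of_contract hf hlf))
      exact exists_eq_cycleMatroid_of_series hef' hcoc hfin hG (hcon.trans hGE)

end Matroid

/-! ### Induced minors -/

namespace Matroid

variable {α β : Type*}

theorem isIsomorphic_iff {M : Matroid α} {N : Matroid β} : M.IsIsomorphic N ↔
    ∃ e : M.E ≃ N.E, ∀ I : Set M.E, M.Indep (Subtype.val '' I) ↔
      N.Indep (Subtype.val '' (e '' I)) := by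
  refine exists_congr fun e => ⟨fun h I => ?_, fun h => ?_⟩
  · have h1 : N.Indep (Subtype.val '' (e '' I)) ↔
        (M.mapSetEquiv e).Indep (Subtype.val '' (e '' I)) := by
      rw [← iff_iff_eq.2 (congrArg (fun N' : Matroid β => N'.Indep (Subtype.val '' (e '' I))) h)]
    rw [h1, mapSetEquiv_indep_iff, Set.preimage_image_eq _ Subtype.val_injective,
      Equiv.symm_image_image]
    exact (and_iff_left (Subtype.coe_image_subset _ _)).symm
  · refine ext_indep rfl fun J hJ => ?_
    have hJ' : J ⊆ N.E := hJ
    rw [mapSetEquiv_indep_iff, and_iff_left hJ', h, Equiv.image_symm_image,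
      Set.image_preimage_eq_inter_range, Subtype.range_coe, Set.inter_eq_left.2 hJ']

theorem isIsomorphic_ofVectors {K W : Type*} [Field K] [AddCommGroup W] [Module K W]
    {v : α → W} {w : β → W} {X : Set α} {Y : Set β} (hv : Set.InjOn v X) (hw : Set.InjOn w Y)
    (h : v '' X = w '' Y) : (ofVectors K v X).IsIsomorphic (ofVectors K w Y) := by
  have hv' : Set.BijOn v X (w '' Y) := h ▸ hv.bijOn_image
  let e : X ≃ Y := (hv'.equiv v).trans (hw.bijOn_image.equiv w).symm
  have he : ∀ x : X, w (e x) = v x := fun x => by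
    have h1 : (hw.bijOn_image.equiv w) (e x) = hv'.equiv v x := Equiv.apply_symm_apply _ _
    exact congrArg Subtype.val h1
  refine isIsomorphic_iff.2 ⟨e, fun (I : Set X) => ?_⟩
  change (Subtype.val '' I ⊆ X ∧ LinearIndepOn K v (Subtype.val '' I)) ↔
    (Subtype.val '' (e '' I) ⊆ Y ∧ LinearIndepOn K w (Subtype.val '' (e '' I)))
  have h1 : (Subtype.val '' I : Set α) ⊆ X := Subtype.coe_image_subset _ _
  have h2 : (Subtype.val '' (e '' I) : Set β) ⊆ Y := Subtype.coe_image_subset _ _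
  have h3 : v '' (Subtype.val '' I) = w '' (Subtype.val '' (e '' I)) := by
    rw [Set.image_image, Set.image_image, Set.image_image]
    exact Set.image_congr fun x _ => (he x).symm
  rw [and_iff_right h1, and_iff_right h2, LinearIndepOn_iff_linearIndepOn_image_injOn,
    LinearIndepOn_iff_linearIndepOn_image_injOn (v := w), and_iff_left (hv.mono h1),
    and_iff_left (hw.mono h2), h3]

/-- `N` is a simple matroid of rank three with at least six elements. -/
def IsLargePlane (N : Matroid α) : Prop :=
  N.IsSimple ∧ (∀ I, N.Indep I → I.encard ≤ 3) ∧ (∃ I, N.Indep I ∧ I.encard = 3) ∧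
    6 ≤ N.E.encard

theorem IsLargePlane.of_isIsomorphic {M : Matroid α} {N : Matroid β} (h : M.IsIsomorphic N)
    (hN : N.IsLargePlane) : M.IsLargePlane := by
  obtain ⟨e, he⟩ := isIsomorphic_iff.1 h
  obtain ⟨hs, hle, ⟨I, hI, hI3⟩, h6⟩ := hN
  have hcard : ∀ I : Set M.E, (Subtype.val '' I).encard = (Subtype.val '' (e '' I)).encard := by
    intro I
    rw [Subtype.val_injective.encard_image, Subtype.val_injective.encard_image,
      e.injective.encard_image]
  have hval : ∀ {I}, I ⊆ M.E → Subtype.val '' (Subtype.val ⁻¹' I : Set M.E) = I := fun hI => by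
    rw [Set.image_preimage_eq_inter_range, Subtype.range_coe, Set.inter_eq_left.2 hI]
  refine ⟨fun x hx y hy => ?_, fun J hJ => ?_, ?_, ?_⟩
  · have h1 := hs _ (e ⟨x, hx⟩).2 _ (e ⟨y, hy⟩).2
    have h2 := (he {⟨x, hx⟩, ⟨y, hy⟩}).2 (by
      rw [Set.image_pair, Set.image_pair]
      exact h1)
    rwa [Set.image_pair] at h2
  · have hJ' := hval hJ.subset_ground
    rw [← hJ', hcard]
    exact hle _ ((he _).1 (hJ'.symm ▸ hJ))
  · have h1 : Subtype.val '' (e '' (e.symm '' (Subtype.val ⁻¹' I : Set N.E))) = I := by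
      rw [Equiv.image_symm_image, Set.image_preimage_eq_inter_range, Subtype.range_coe,
        Set.inter_eq_left.2 hI.subset_ground]
    refine ⟨_, (he (e.symm '' (Subtype.val ⁻¹' I : Set N.E))).2 (h1.symm ▸ hI), ?_⟩
    rw [hcard, h1, hI3]
  · have h1 : M.E.encard = N.E.encard := Set.encard_congr e
    rwa [h1]

/-- Being an ordinary minor is all that is used of an induced minor when showing that
series-parallel networks exclude both matroids. -/
theorem IsInducedMinorOf.isMinor {M N : Matroid α} (h : M.IsInducedMinorOf N) : N ≤m M := by
  induction h with
  | refl => exact IsMinor.refl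
  | @restrict N F _ hF ih =>
    refine IsMinor.trans ⟨∅, N.E \ F, ?_⟩ ih
    rw [contract_empty, delete_compl hF.subset_ground]
  | @contract N N' C _ hC hN' ih =>
    obtain ⟨X, hX, -, rfl⟩ := hN'
    refine IsMinor.trans ⟨C, (N.contract C).E \ X, ?_⟩ ih
    rw [delete_compl fun x hx => (hX x hx).mem_ground]

/-! ### From minors of rank three to projections -/

section HasK4Projection

variable {W : Type*} [AddCommGroup W] [Module (ZMod 2) W] {v : α → W} {E X : Set α}

/-- Extend a basis `{a, b, c}` of `X` to one of `E` and project onto the coordinates `a`, `b`, `c`.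
The other basis elements span the kernel. The projection is injective on the span of `X`, so the
elements of the simple matroid on `X` take at least six of the seven nonzero values. -/
theorem HasK4Projection.of_isLargePlane_restrict (hE : E.Finite) (hX : X ⊆ E)
    (h : (ofVectors (ZMod 2) v X).IsLargePlane) : HasK4Projection (v '' E) := by
  classical
  obtain ⟨hs, hle, ⟨I, hI, hI3⟩, h6⟩ := h
  obtain ⟨a, b, c, hab, hac, hbc, rfl⟩ := Set.encard_eq_three.1 hI3
  have hspan : Submodule.span (ZMod 2) (v '' {a, b, c}) = Submodule.span (ZMod 2) (v '' X) := by
    have hbase : (ofVectors (ZMod 2) v X).IsBase {a, b, c} := by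
      obtain ⟨B, hB, hIB⟩ := hI.exists_isBase_superset
      have h1 := Set.Finite.eq_of_subset_of_encard_le (Set.toFinite {a, b, c}) hIB
        ((hle B hB.indep).trans hI3.ge)
      rwa [h1]
    exact ofVectors_span_of_isBasis hbase.isBasis_ground
  have haE := hX (hI.1 (show a ∈ ({a, b, c} : Set α) by simp))
  have hbE := hX (hI.1 (show b ∈ ({a, b, c} : Set α) by simp))
  have hcE := hX (hI.1 (show c ∈ ({a, b, c} : Set α) by simp))
  have : Finite E := hE
  have hrange : v '' E = Set.range fun e : E => v e := Set.image_eq_range _ _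
  have hind : LinearIndepOn (ZMod 2) (fun e : E => v e) {⟨a, haE⟩, ⟨b, hbE⟩, ⟨c, hcE⟩} := by
    refine LinearIndepOn.comp_of_image (v := v) (f := Subtype.val) ?_ Subtype.val_injective.injOn
    convert! hI.2 using 1
    rw [Set.image_insert_eq, Set.image_pair]
  obtain ⟨κ, hκ⟩ := exists_coordinateSystem hind
  have haB : (⟨a, haE⟩ : E) ∈ κ.B := hκ (by simp)
  have hbB : (⟨b, hbE⟩ : E) ∈ κ.B := hκ (by simp)
  have hcB : (⟨c, hcE⟩ : E) ∈ κ.B := hκ (by simp)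
  set φ := κ.proj ⟨a, haE⟩ ⟨b, hbE⟩ {⟨c, hcE⟩} with hφ
  have hinj : ∀ w ∈ Submodule.span (ZMod 2) (v '' X), φ w = 0 → w = 0 := by
    intro w hw h0
    rw [hφ, κ.proj_apply, Finset.sum_singleton] at h0
    have h1 : κ.l ⟨a, haE⟩ w = 0 := congrFun h0 0
    have h2 : κ.l ⟨b, hbE⟩ w = 0 := congrFun h0 1
    have h3 : κ.l ⟨c, hcE⟩ w = 0 := congrFun h0 2
    have hwE : w ∈ Submodule.span (ZMod 2) (Set.range fun e : E => v e) := by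
      rw [← hrange]
      exact Submodule.span_mono (Set.image_mono hX) hw
    rw [← κ.sum_eq w hwE]
    refine Finset.sum_eq_zero fun x hx => ?_
    by_cases hxa : x = ⟨a, haE⟩
    · rw [hxa, h1, zero_smul]
    by_cases hxb : x = ⟨b, hbE⟩
    · rw [hxb, h2, zero_smul]
    by_cases hxc : x = ⟨c, hcE⟩
    · rw [hxc, h3, zero_smul]
    have h4 : Submodule.span (ZMod 2) (v '' {a, b, c}) ≤ LinearMap.ker (κ.l x) := by
      rw [Submodule.span_le]
      rintro _ ⟨y, rfl | rfl | rfl, rfl⟩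
      · exact κ.l_of_ne x hx _ haB hxa
      · exact κ.l_of_ne x hx _ hbB hxb
      · exact κ.l_of_ne x hx _ hcB hxc
    have h5 : κ.l x w = 0 := h4 (hspan ▸ hw)
    rw [h5, zero_smul]
  have hinjOn : Set.InjOn (φ ∘ v) X := by
    intro x hx y hy hxy
    by_contra hne
    have h1 : v x = v y := by
      refine sub_eq_zero.1 (hinj _ (Submodule.sub_mem _ (Submodule.subset_span ⟨x, hx, rfl⟩)
        (Submodule.subset_span ⟨y, hy, rfl⟩)) ?_)
      rw [map_sub]
      exact sub_eq_zero.2 hxy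
    exact hne ((hs x hx y hy).2.injOn (by simp) (by simp) h1)
  have hne0 : ∀ x ∈ X, φ (v x) ≠ 0 := by
    intro x hx h0
    have h1 := hinj _ (Submodule.subset_span ⟨x, hx, rfl⟩) h0
    have h2 := (hs x hx x hx).2
    rw [Set.pair_eq_singleton, linearIndepOn_singleton_iff] at h2
    exact h2 h1
  rw [hrange]
  refine ⟨φ, fun w hw h0 => κ.proj_ker haB hbB (by simpa using hcB) (j₀ := ⟨c, hcE⟩) ?_ hw h0, ?_⟩
  · intro j hj
    rw [Finset.mem_singleton.1 hj, add_self_eq_zero_of_zmod_two]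
    exact Submodule.zero_mem _
  · by_contra! hcon
    -- With exceptions `0` and then `z₁`, two distinct nonzero values are missed, which leaves room
    -- for only five.
    obtain ⟨z₁, hz₁, -, h1⟩ := hcon 0
    obtain ⟨z₂, hz₂, hz₁₂, h2⟩ := hcon z₁
    have hsub : (φ ∘ v) '' X ⊆ (({0, z₁, z₂}ᶜ : Finset (Fin 3 → ZMod 2)) : Set _) := by
      rintro _ ⟨x, hx, rfl⟩
      simp only [Finset.coe_compl, Finset.coe_insert, Finset.coe_singleton, Set.mem_compl_iff,
        Set.mem_insert_iff, Set.mem_singleton_iff, not_or]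
      exact ⟨hne0 x hx, fun h => h1 _ ⟨⟨x, hX hx⟩, rfl⟩ h, fun h => h2 _ ⟨⟨x, hX hx⟩, rfl⟩ h⟩
    have h3 := Set.encard_le_encard hsub
    rw [hinjOn.encard_image, Set.encard_coe_eq_coe_finsetCard, Finset.card_compl,
      Finset.card_eq_three.2 ⟨0, z₁, z₂, hz₁.symm, hz₂.symm, hz₁₂.symm, rfl⟩] at h3
    have h4 : (6 : ℕ∞) ≤ ((Fintype.card (Fin 3 → ZMod 2) - 3 : ℕ) : ℕ∞) := h6.trans h3
    have h5 : Fintype.card (Fin 3 → ZMod 2) = 8 := by decide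
    rw [h5] at h4
    exact absurd h4 (by decide)

/-- Write the minor as a contraction followed by a deletion. The deletion is handled by the
restriction case, the contraction by composing with the quotient map. -/
theorem HasK4Projection.of_isMinor {N : Matroid α} (hE : E.Finite)
    (h : N ≤m ofVectors (ZMod 2) v E) (hN : N.IsLargePlane) : HasK4Projection (v '' E) := by
  obtain ⟨C, D, hC, -, -, rfl⟩ := h.exists_eq_contract_delete_disjoint
  have hC : C ⊆ E := hC
  set U := Submodule.span (ZMod 2) (v '' C) with hU
  rw [ofVectors_contract hC (L := U.mkQ) (fun w _ => by
    rw [Submodule.mkQ_apply, Submodule.Quotient.mk_eq_zero]), delete_eq_restrict,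
    ofVectors_ground, ofVectors_restrict Set.sdiff_subset] at hN
  have h1 := HasK4Projection.of_isLargePlane_restrict (hE.sdiff) Set.sdiff_subset hN
  have hz : ∀ e ∈ C, U.mkQ (v e) = 0 := fun e he => by
    rw [Submodule.mkQ_apply, Submodule.Quotient.mk_eq_zero]
    exact Submodule.subset_span ⟨e, he, rfl⟩
  refine HasK4Projection.of_image (L := U.mkQ) (fun w _ h0 => ?_) (h1.congr fun s hs => ?_)
  · rw [Submodule.mkQ_apply, Submodule.Quotient.mk_eq_zero] at h0
    refine Submodule.span_mono ?_ h0
    rintro _ ⟨e, he, rfl⟩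
    exact ⟨⟨e, hC he, rfl⟩, hz e he⟩
  · constructor
    · rintro ⟨e, he, rfl⟩
      exact ⟨_, ⟨e, he.1, rfl⟩, rfl⟩
    · rintro ⟨_, ⟨e, he, rfl⟩, rfl⟩
      exact ⟨e, ⟨he, fun heC => hs (hz e heC)⟩, rfl⟩

end HasK4Projection

/-! ### The matroids `M(K₄)` and `F₇` -/

theorem linearIndepOn_pair_of_ne {x y : Fin 3 → ZMod 2} (hx : x ≠ 0) (hy : y ≠ 0) :
    LinearIndepOn (ZMod 2) id {x, y} := by
  by_cases hxy : x = y
  · rw [hxy, Set.pair_eq_singleton, linearIndepOn_singleton_iff]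
    exact hy
  · rw [LinearIndepOn.pair_iff _ hxy]
    intro a b hab
    rcases ZMod.two_eq_zero_or_one a with rfl | rfl <;>
      rcases ZMod.two_eq_zero_or_one b with rfl | rfl
    · exact ⟨rfl, rfl⟩
    · simp [hy] at hab
    · simp [hx] at hab
    · refine absurd ?_ hxy
      simp only [one_smul, id] at hab
      have h1 := add_self_eq_zero_of_zmod_two y
      exact add_right_cancel (hab.trans h1.symm)

theorem isLargePlane_ofVectors_id {T : Set (Fin 3 → ZMod 2)} (h0 : 0 ∉ T)
    (hT : ∀ z, z ≠ 0 → z ≠ ![1, 1, 1] → z ∈ T) : (ofVectors (ZMod 2) id T).IsLargePlane := by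
  refine ⟨fun x hx y hy => ?_, fun I hI => ?_, ⟨Set.range ![![1, 0, 0], ![0, 1, 0], ![0, 0, 1]], ?_, ?_⟩, ?_⟩
  · exact ⟨Set.pair_subset hx hy, linearIndepOn_pair_of_ne (fun h => h0 (h ▸ hx))
      (fun h => h0 (h ▸ hy))⟩
  · have h1 : LinearIndependent (ZMod 2) (fun x : I => (x : Fin 3 → ZMod 2)) := hI.2
    have h2 := h1.cardinal_le_rank
    rw [rank_fin_fun] at h2
    have : Finite I := Set.toFinite I
    rw [← Set.Finite.cast_ncard_eq (Set.toFinite I)]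
    rw [← Nat.cast_card] at h2
    exact_mod_cast h2
  · refine ⟨?_, ?_⟩
    · rintro _ ⟨i, rfl⟩
      refine hT _ ?_ ?_ <;> fin_cases i <;> decide
    · refine LinearIndependent.linearIndepOn_id ?_
      rw [Fintype.linearIndependent_iff]
      intro g hg i
      have h1 := congrFun hg i
      simp only [Fin.sum_univ_three] at h1
      fin_cases i <;> simpa using h1
  · have hinj : Function.Injective
        (![![1, 0, 0], ![0, 1, 0], ![0, 0, 1]] : Fin 3 → Fin 3 → ZMod 2) := by decide
    rw [← Set.image_univ, hinj.encard_image, Set.encard_univ]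
    simp
  · have hsub : (({0, ![1, 1, 1]}ᶜ : Finset (Fin 3 → ZMod 2)) : Set _) ⊆ T := by
      intro z hz
      simp only [Finset.coe_compl, Finset.coe_insert, Finset.coe_singleton, Set.mem_compl_iff,
        Set.mem_insert_iff, Set.mem_singleton_iff, not_or] at hz
      exact hT z hz.1 hz.2
    refine le_trans ?_ (Set.encard_le_encard hsub)
    rw [Set.encard_coe_eq_coe_finsetCard]
    decide

/-- The points of the Fano plane that represent the four vertices of `K₄`; an edge is represented by
the sum of its ends. -/
def k4Point : Fin 4 → Fin 3 → ZMod 2 := ![0, ![1, 0, 0], ![0, 1, 0], ![0, 0, 1]]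

/-- The point of the Fano plane representing an edge of `K₄`. -/
def k4Vector : Sym2 (Fin 4) → Fin 3 → ZMod 2 :=
  Sym2.lift ⟨fun i j => k4Point i + k4Point j, fun _ _ => add_comm _ _⟩

theorem cycleK4_eq_ofVectors :
    cycleK4 = ofVectors (ZMod 2) k4Vector (⊤ : SimpleGraph (Fin 4)).edgeSet := by
  rw [cycleK4, Graph.cycleMatroid_eq_ofVectors]
  set G := Graph.ofSimpleGraph (⊤ : SimpleGraph (Fin 4)) with hG
  let L : (Fin 4 →₀ ZMod 2) →ₗ[ZMod 2] (Fin 3 → ZMod 2) :=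
    Finsupp.linearCombination (ZMod 2) k4Point
  have hlink : ∀ e ∈ G.edgeSet, ∃ i j, e = s(i, j) ∧
      G.incVec e = Finsupp.single i 1 + Finsupp.single j 1 := by
    intro e he
    obtain ⟨i, j, hij⟩ := G.exists_isLink_of_mem_edgeSet he
    exact ⟨i, j, hij.1, hij.incVec_eq⟩
  rw [← ofVectors_comp (L := L)]
  · refine ofVectors_congr fun e he => ?_
    obtain ⟨i, j, rfl, hv⟩ := hlink e he
    simp [hv, L, k4Vector]
  · intro w hw h0
    -- `L` sends vertex `0` to zero, so it is injective only on the even-weight vectors, where the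
    -- other three coordinates determine the one at `0`.
    have hsum : Submodule.span (ZMod 2) (G.incVec '' G.edgeSet) ≤
        LinearMap.ker (Finsupp.linearCombination (ZMod 2) (fun _ : Fin 4 => (1 : ZMod 2))) := by
      rw [Submodule.span_le]
      rintro _ ⟨e, he, rfl⟩
      obtain ⟨i, j, rfl, hv⟩ := hlink e he
      simp only [SetLike.mem_coe, LinearMap.mem_ker, hv, map_add,
        Finsupp.linearCombination_single]
      rfl
    have h1 := hsum hw
    rw [LinearMap.mem_ker, Finsupp.linearCombination_apply, Finsupp.sum_fintype _ _ (by simp),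
      Fin.sum_univ_four] at h1
    simp only [L] at h0
    rw [Finsupp.linearCombination_apply, Finsupp.sum_fintype _ _ (by simp),
      Fin.sum_univ_four] at h0
    have e1 := congrFun h0 0
    have e2 := congrFun h0 1
    have e3 := congrFun h0 2
    simp [k4Point] at e1 e2 e3 h1
    ext i
    fin_cases i <;> simp_all

theorem k4Vector_injOn : Set.InjOn k4Vector (⊤ : SimpleGraph (Fin 4)).edgeSet := by
  have key : ∀ i j k l : Fin 4, i ≠ j → k ≠ l → k4Point i + k4Point j = k4Point k + k4Point l →
      i = k ∧ j = l ∨ i = l ∧ j = k := by decide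
  intro a ha b hb
  induction a with | h i j => ?_
  induction b with | h k l => ?_
  intro h
  exact Sym2.eq_iff.2 (key i j k l ha hb h)

theorem k4Vector_image :
    k4Vector '' (⊤ : SimpleGraph (Fin 4)).edgeSet = {z | z ≠ 0 ∧ z ≠ ![1, 1, 1]} := by
  have h1 : ∀ i j : Fin 4, i ≠ j → k4Point i + k4Point j ≠ 0 ∧
      k4Point i + k4Point j ≠ ![1, 1, 1] := by decide
  have h2 : ∀ z : Fin 3 → ZMod 2, z ≠ 0 → z ≠ ![1, 1, 1] →
      ∃ i j : Fin 4, i ≠ j ∧ k4Point i + k4Point j = z := by decide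
  ext z
  constructor
  · rintro ⟨e, he, rfl⟩
    induction e with | h i j => ?_
    exact h1 i j he
  · rintro ⟨hz, hz'⟩
    obtain ⟨i, j, hij, h⟩ := h2 z hz hz'
    exact ⟨s(i, j), hij, h⟩

theorem isLargePlane_cycleK4 : cycleK4.IsLargePlane := by
  refine IsLargePlane.of_isIsomorphic (N := ofVectors (ZMod 2) id {z | z ≠ 0 ∧ z ≠ ![1, 1, 1]})
    ?_ (isLargePlane_ofVectors_id (fun h => h.1 rfl) fun z h1 h2 => ⟨h1, h2⟩)
  rw [cycleK4_eq_ofVectors]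
  exact isIsomorphic_ofVectors k4Vector_injOn Function.injective_id.injOn
    (by rw [k4Vector_image, Set.image_id])

theorem isLargePlane_fano : fano.IsLargePlane :=
  isLargePlane_ofVectors_id (fun h => h rfl) fun _ h1 _ => h1

/-- A transvection along `t + ![1, 1, 1]`, taken with a functional equal to one at both points,
exchanges them. Hence all points of the Fano plane are alike and removing any one gives `M(K₄)`. -/
theorem exists_involution_apply_eq {t : Fin 3 → ZMod 2} (ht : t ≠ 0) :
    ∃ A : (Fin 3 → ZMod 2) →ₗ[ZMod 2] (Fin 3 → ZMod 2), (∀ z, A (A z) = z) ∧ A t = ![1, 1, 1] := by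
  have hm : ∀ t : Fin 3 → ZMod 2, t ≠ 0 → ∃ m : Fin 3 → ZMod 2,
      t ⬝ᵥ m = 1 ∧ ![1, 1, 1] ⬝ᵥ m = 1 := by decide
  obtain ⟨m, hmt, hm1⟩ := hm t ht
  let l : (Fin 3 → ZMod 2) →ₗ[ZMod 2] ZMod 2 := (dotProductBilin (ZMod 2) (ZMod 2)).flip m
  have hlt : l t = 1 := hmt
  have hl1 : l ![1, 1, 1] = 1 := hm1
  have hl : l (t + ![1, 1, 1]) = 0 := by rw [map_add, hlt, hl1]; rfl
  refine ⟨LinearMap.transvection l (t + ![1, 1, 1]), fun z => ?_, ?_⟩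
  · rw [LinearMap.transvection.apply, LinearMap.transvection.apply, map_add, map_smul, hl,
      smul_zero, add_zero, add_assoc, add_self_eq_zero_of_zmod_two, add_zero]
  · rw [LinearMap.transvection.apply, hlt, one_smul, ← add_assoc, add_self_eq_zero_of_zmod_two,
      zero_add]

theorem isIsomorphic_fano_or_cycleK4 {w : α → Fin 3 → ZMod 2} {X : Set α} (hw : Set.InjOn w X)
    (h0 : ∀ x ∈ X, w x ≠ 0) {t : Fin 3 → ZMod 2} (ht : ∀ z, z ≠ 0 → z ≠ t → z ∈ w '' X) :
    (ofVectors (ZMod 2) w X).IsIsomorphic cycleK4 ∨ (ofVectors (ZMod 2) w X).IsIsomorphic fano := by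
  by_cases htX : t = 0 ∨ t ∈ w '' X
  · right
    refine isIsomorphic_ofVectors hw Function.injective_id.injOn ?_
    rw [Set.image_id]
    refine Set.Subset.antisymm ?_ fun z hz => ?_
    · rintro _ ⟨x, hx, rfl⟩
      exact h0 x hx
    · by_cases hzt : z = t
      · rcases htX with h | h
        · exact absurd (hzt.trans h) hz
        · rwa [hzt]
      · exact ht z hz hzt
  · push Not at htX
    left
    obtain ⟨A, hA, hAt⟩ := exists_involution_apply_eq htX.1
    have hA0 : ∀ z, A z = 0 → z = 0 := fun z hz => by rw [← hA z, hz, map_zero]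
    have hAinj : ∀ y z, A y = A z → y = z := fun y z h => by rw [← hA y, h, hA]
    rw [cycleK4_eq_ofVectors, ← ofVectors_comp (L := A) fun z _ => hA0 z]
    refine isIsomorphic_ofVectors (fun x hx y hy hxy => hw hx hy (hAinj _ _ hxy)) k4Vector_injOn ?_
    rw [k4Vector_image]
    ext z
    constructor
    · rintro ⟨x, hx, rfl⟩
      refine ⟨fun h => h0 x hx (hA0 _ h), fun h => htX.2 ⟨x, hx, hAinj _ _ (h.trans hAt.symm)⟩⟩
    · rintro ⟨hz0, hz1⟩
      obtain ⟨x, hx, hxz⟩ := ht (A z) (fun h => hz0 (hA0 z h)) fun h => hz1 (by rw [← hA z, h, hAt])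
      exact ⟨x, hx, by rw [Function.comp_apply, hxz, hA]⟩

/-- Over `GF(2)` two nonloops are parallel exactly when their vectors are equal, so a simplification
picks one element for each nonzero value. -/
theorem isSimplificationOf_ofVectors {W : Type*} [AddCommGroup W] [Module (ZMod 2) W] {v : α → W}
    {E X : Set α} (hX : X ⊆ E) (hinj : Set.InjOn v X) (hX0 : ∀ x ∈ X, v x ≠ 0)
    (hsurj : ∀ e ∈ E, v e ≠ 0 → ∃ x ∈ X, v x = v e) :
    (ofVectors (ZMod 2) v X).IsSimplificationOf (ofVectors (ZMod 2) v E) := by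
  have hnl : ∀ {e}, (ofVectors (ZMod 2) v E).IsNonloop e ↔ e ∈ E ∧ v e ≠ 0 := by
    intro e
    constructor
    · intro h
      exact ⟨h.mem_ground, fun h0 => h.not_isLoop ((ofVectors_isLoop_iff h.mem_ground).2 h0)⟩
    · rintro ⟨he, h0⟩
      exact (not_isLoop_iff he).1 fun h => h0 ((ofVectors_isLoop_iff he).1 h)
  refine ⟨X, fun x hx => hnl.2 ⟨hX hx, hX0 x hx⟩, fun e he => ?_, (ofVectors_restrict hX).symm⟩
  obtain ⟨heE, he0⟩ := hnl.1 he
  obtain ⟨x, hx, hxe⟩ := hsurj e heE he0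
  refine ⟨x, ⟨hx, ?_⟩, ?_⟩
  · ext f
    rw [mem_ofVectors_closure_iff (by simpa using hX hx), mem_ofVectors_closure_iff (by simpa),
      Set.image_singleton, Set.image_singleton, hxe]
  · rintro y ⟨hy, hye⟩
    have h1 : y ∈ (ofVectors (ZMod 2) v E).closure {e} := by
      rw [← hye, mem_ofVectors_closure_iff (by simpa using hX hy), Set.image_singleton]
      exact ⟨hX hy, Submodule.mem_span_singleton_self _⟩
    rw [mem_ofVectors_closure_iff (by simpa), Set.image_singleton,
      Submodule.mem_span_singleton] at h1
    obtain ⟨-, a, ha⟩ := h1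
    refine hinj hy hx ?_
    rw [hxe]
    rcases ZMod.two_eq_zero_or_one a with rfl | rfl
    · exact absurd (by rw [← ha, zero_smul]) (hX0 y hy)
    · rw [← ha, one_smul]

/-- Contract all elements killed by the projection; by the kernel condition the map represents this
contraction. One element for each remaining value gives a simplification, so a single contraction
step suffices. -/
theorem hasInducedMinor_of_hasK4Projection {W : Type*} [AddCommGroup W] [Module (ZMod 2) W]
    {v : α → W} {E : Set α} (h : HasK4Projection (v '' E)) :
    (ofVectors (ZMod 2) v E).HasInducedMinor cycleK4 ∨
      (ofVectors (ZMod 2) v E).HasInducedMinor fano := by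
  obtain ⟨φ, hker, t, ht⟩ := h
  set C := {e ∈ E | φ (v e) = 0} with hC
  have hCE : C ⊆ E := fun e he => he.1
  have hcon : (ofVectors (ZMod 2) v E).contract C = ofVectors (ZMod 2) (φ ∘ v) (E \ C) := by
    refine ofVectors_contract hCE fun w hw => ⟨fun h0 => ?_, fun hw' => ?_⟩
    · refine Submodule.span_mono ?_ (hker w hw h0)
      rintro _ ⟨⟨e, he, rfl⟩, h0⟩
      exact ⟨e, ⟨he, h0⟩, rfl⟩
    · have h1 : Submodule.span (ZMod 2) (v '' C) ≤ LinearMap.ker φ := by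
        rw [Submodule.span_le]
        rintro _ ⟨e, he, rfl⟩
        exact he.2
      exact h1 hw'
  obtain ⟨X, hXE, hX⟩ := (Set.surjOn_image (φ ∘ v) (E \ C)).exists_bijOn_subset
  have hX0 : ∀ x ∈ X, (φ ∘ v) x ≠ 0 := fun x hx h0 => (hXE hx).2 ⟨(hXE hx).1, h0⟩
  have hsimp : (ofVectors (ZMod 2) (φ ∘ v) X).IsSimplificationOf
      ((ofVectors (ZMod 2) v E).contract C) := by
    rw [hcon]
    exact isSimplificationOf_ofVectors hXE hX.injOn hX0 fun e he _ => hX.surjOn ⟨e, he, rfl⟩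
  have hind := IsInducedMinorOf.contract (M := ofVectors (ZMod 2) v E) .refl hCE hsimp
  refine (isIsomorphic_fano_or_cycleK4 hX.injOn hX0 (t := t) fun z hz hzt => ?_).imp
    (fun h => ⟨_, hind, h⟩) (fun h => ⟨_, hind, h⟩)
  rw [hX.image_eq]
  obtain ⟨_, ⟨e, he, rfl⟩, rfl⟩ := ht z hz hzt
  exact ⟨e, ⟨he, fun h => hz h.2⟩, rfl⟩

/-- The span of finitely many vectors is finite-dimensional; its coordinate map extends to all of
`W` and is injective where it matters. -/
theorem isBinary_ofVectors {W : Type*} [AddCommGroup W] [Module (ZMod 2) W] {v : α → W} {E : Set α}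
    (hE : E.Finite) : (ofVectors (ZMod 2) v E).IsBinary := by
  set U := Submodule.span (ZMod 2) (v '' E) with hU
  have : FiniteDimensional (ZMod 2) U := FiniteDimensional.span_of_finite _ (hE.image v)
  obtain ⟨L, hL⟩ := LinearMap.exists_extend
    (Module.finBasis (ZMod 2) U).equivFun.toLinearMap
  refine ⟨_, L ∘ v, (ofVectors_comp fun w hw h0 => ?_).symm⟩
  have h1 : L w = (Module.finBasis (ZMod 2) U).equivFun ⟨w, hw⟩ := DFunLike.congr_fun hL ⟨w, hw⟩
  rw [h0, eq_comm, LinearEquiv.map_eq_zero_iff] at h1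
  exact congrArg Subtype.val h1

theorem not_hasInducedMinor_of_not_hasK4Projection {W : Type*} [AddCommGroup W]
    [Module (ZMod 2) W] {v : α → W} {E : Set α} (hE : E.Finite) (h : ¬ HasK4Projection (v '' E))
    {N : Matroid β} (hN : N.IsLargePlane) : ¬ (ofVectors (ZMod 2) v E).HasInducedMinor N := by
  rintro ⟨M', hM', hiso⟩
  exact h (HasK4Projection.of_isMinor hE hM'.isMinor (hN.of_isIsomorphic hiso))

end Matroid

theorem mainTheorem9 {α : Type*} (M : Matroid α) [M.Finite] :
    (M.IsSimple ∧ M.IsBinary ∧ M.IsConnected ∧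
        ¬ M.HasInducedMinor Matroid.cycleK4 ∧ ¬ M.HasInducedMinor Matroid.fano) ↔
      (M.IsSimple ∧ M.IsSeriesParallelNetwork) := by
  refine and_congr_right fun _ => ⟨?_, ?_⟩
  · rintro ⟨⟨n, v, hv⟩, hconn, hK4, hF7⟩
    have hK : ¬ HasK4Projection (v '' M.E) := fun h => by
      have h1 := Matroid.hasInducedMinor_of_hasK4Projection h
      rw [← hv] at h1
      exact h1.elim hK4 hF7
    obtain ⟨G, -, hG, hGE⟩ := Matroid.exists_eq_cycleMatroid_of_not_hasK4Projection _ v M.E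
      M.ground_finite rfl (hv ▸ hconn) hK
    exact ⟨ℕ, G, hG, hv.trans hGE⟩
  · rintro ⟨V, G, hG, rfl⟩
    obtain ⟨hconn, hK⟩ := hG.isConnected_and_not_hasK4Projection
    have hE : G.edgeSet.Finite := G.cycleMatroid.ground_finite
    refine ⟨?_, hconn, ?_⟩
    · rw [Graph.cycleMatroid_eq_ofVectors]
      exact Matroid.isBinary_ofVectors hE
    · rw [Graph.cycleMatroid_eq_ofVectors]
      exact ⟨Matroid.not_hasInducedMinor_of_not_hasK4Projection hE hK Matroid.isLargePlane_cycleK4,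
        Matroid.not_hasInducedMinor_of_not_hasK4Projection hE hK Matroid.isLargePlane_fano⟩
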